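/- \textbf{Setting.} Let $\mathcal Y$ be a (real or complex) Hilbert space. (A) $A$ is a normal operator on $\mathcal Y$ (densely defined, closed, $AA^*=A^*A$) which generates a $C^0$-semigroup $e^{tA}$; $\omega\in\mathbb R$ is such that $\|e^{tA}\|\le e^{\omega t}$ for all $t\ge 0$. For $r\ge 0$ let $\mathbb P_r$ be the spectral projector of $A$ onto $\{\lambda\in\operatorname{spec}A:|\lambda|\le r\}$ (on a real space: of $|A|=(A^*A)^{1/2}$ onto $[0,r]$), let $\mathbb P=\mathbb P_1$ and $\mathbb Q=1-\mathbb P$. For $\ell\in\mathbb N_0$ let $\mathcal Y_\ell=D(A^\ell)$ with $\langle U,V\rangle_{\mathcal Y_\ell}=\langle\mathbb PU,\mathbb PV\rangle+\langle|A|^\ell\mathbb QU,|A|^\ell\mathbb QV\rangle$, so that $\mathcal Y_0=\mathcal Y$. (B1) $K\in\mathbb N_0$, $N\in\mathbb N$, $N>K$, and $\mathcal D_K\subset\dots\subset\mathcal D_0$ are such that, for $k=0,\dots,K$, the set $\mathcal D_k\subset\mathcal Y_k$ is open and bounded in $\mathcal Y_k$, $B$ maps $\mathcal D_k$ into $\mathcal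 Y_k$, and $B\in C_b^{N-k}(\mathcal D_k,\mathcal Y_k)$: as a map into $\mathcal Y_k$, $B$ is $N-k$ times continuously (real) Fréchet differentiable on $\mathcal D_k$, and its derivatives of order $j=0,\dots,N-k$ are bounded, by $M_k^{(j)}$, and extend continuously to the boundary. Let $\mathcal D_{K+1}\subset\mathcal D_K$ be an open subset of $\mathcal Y_{K+1}$ which is bounded in $\mathcal Y_{K+1}$, let $R_{K+1}=\sup_{U\in\mathcal D_{K+1}}\|U\|_{\mathcal Y_{K+1}}$, and for $\delta>0$ let $$\mathcal D_{K+1}^{-\delta}=\{U\in\mathcal D_{K+1}:\operatorname{dist}_{\mathcal Y_j}(U,\partial\mathcal D_j)>\delta\ \text{ for } j=0,\dots,K+1\},$$ where $\partial\mathcal D_j$ is the boundary of $\mathcal D_j$ in $\mathcal Y_j$ and $\operatorname{dist}(U,\emptyset)=\infty$. A mild solution on $[0,T]$ of $\dot U=AU+B(U)$ is a function $U$ with $U(t)=e^{tA}U(0)+\int_0^te^{(t-s)A}B(U(s))\,ds$ for $t\in[0,T]$. The projected system is $\dot u_m=Au_m+\mathbb P_mB(u_m)$, posed on the range of $\mathbb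 P_m$. \textbf{Corollary (Convergence of the projected system -- higher order error bounds).} Assume (A) and (B1), let $T\ge 0$, and let $\delta>0$ be such that $\mathcal D_{K+1}^{-\delta}$ is nonempty. Then there are $m_*\in\mathbb N$ and $C\in\mathbb R$, which depend only on $K$, $N$, the bounds $M_k^{(j)}$, $\omega$, $R_{K+1}$, $\delta$ and $T$, such that for every $m\ge m_*$ and every mild solution $U\in C([0,T];\mathcal D_{K+1}^{-\delta})$ (continuous in the norm of $\mathcal Y_{K+1}$) there is a solution $u_m\in C([0,T];\mathcal D_K\cap\mathcal Y_{K+1})$ of the projected system with initial value $u_m(0)=\mathbb P_mU(0)$ such that $$\sup_{t\in[0,T]}\|U(t)-u_m(t)\|_{\mathcal Y}\le C\,m^{-K-1}.$$ -/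

import Mathlib

open Set Filter Topology
open scoped LinearPMap

noncomputable section

namespace Galerkin

/-! ### Compositions and powers of unbounded operators -/

section PMap

variable {𝕜 E : Type*} [RCLike 𝕜] [NormedAddCommGroup E] [InnerProductSpace 𝕜 E]

/-- The composition `g f` with its natural domain `{x ∈ D(f) | f x ∈ D(g)}`. -/
def pcomp (g f : E →ₗ.[𝕜] E) : E →ₗ.[𝕜] E where
  domain := (g.domain.comap f.toFun).map f.domain.subtype
  toFun :=
    { toFun := fun x => g ⟨f ⟨x.1, by
          obtain ⟨y, _, hy⟩ := x.2; rw [← hy]; exact y.2⟩, by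
          obtain ⟨x, y, hy, rfl⟩ := x; exact hy⟩
      map_add' := by
        intro x y
        rw [← LinearPMap.map_add]
        congr 1
        apply Subtype.ext
        simp only [Submodule.coe_add]
        rw [← LinearPMap.map_add]
        rfl
      map_smul' := by
        intro c x
        rw [RingHom.id_apply, ← LinearPMap.map_smul]
        congr 1
        apply Subtype.ext
        simp only [Submodule.coe_smul]
        rw [← LinearPMap.map_smul]
        rfl }

/-- The power `f ^ n` with its natural domain; `f ^ 0` is the identity on the whole space and
`f ^ (n + 1) = f ^ n f`. -/
def ppow (f : E →ₗ.[𝕜] E) : ℕ → (E →ₗ.[𝕜] E)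
  | 0 => (LinearMap.id : E →ₗ[𝕜] E).toPMap ⊤
  | n + 1 => pcomp (ppow f n) f

theorem mem_pcomp {g f : E →ₗ.[𝕜] E} {x : E} :
    x ∈ (pcomp g f).domain ↔ ∃ h : x ∈ f.domain, f ⟨x, h⟩ ∈ g.domain := by
  constructor
  · rintro ⟨y, hy, rfl⟩
    exact ⟨y.2, hy⟩
  · rintro ⟨h, h'⟩
    exact ⟨⟨x, h⟩, h', rfl⟩

theorem pcomp_apply {g f : E →ₗ.[𝕜] E} {x : E} (hx : x ∈ (pcomp g f).domain)
    (h : x ∈ f.domain) (h' : f ⟨x, h⟩ ∈ g.domain) :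
    pcomp g f ⟨x, hx⟩ = g ⟨f ⟨x, h⟩, h'⟩ := rfl

theorem mem_ppow_zero (f : E →ₗ.[𝕜] E) (x : E) : x ∈ (ppow f 0).domain := trivial

theorem ppow_zero_apply (f : E →ₗ.[𝕜] E) (x : E) (h : x ∈ (ppow f 0).domain) :
    ppow f 0 ⟨x, h⟩ = x := rfl

theorem mem_ppow_succ {f : E →ₗ.[𝕜] E} {n : ℕ} {x : E} :
    x ∈ (ppow f (n + 1)).domain ↔ ∃ h : x ∈ f.domain, f ⟨x, h⟩ ∈ (ppow f n).domain :=
  mem_pcomp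

theorem ppow_domain_succ_le (f : E →ₗ.[𝕜] E) (n : ℕ) :
    (ppow f (n + 1)).domain ≤ (ppow f n).domain := by
  induction n with
  | zero => intro x _; trivial
  | succ n ih =>
    intro x hx
    obtain ⟨h, h'⟩ := mem_ppow_succ.1 hx
    exact mem_ppow_succ.2 ⟨h, ih h'⟩

theorem ppow_domain_le (f : E →ₗ.[𝕜] E) {k l : ℕ} (h : k ≤ l) :
    (ppow f l).domain ≤ (ppow f k).domain :=
  antitone_nat_of_succ_le (f := fun n => (ppow f n).domain) (ppow_domain_succ_le f) h

end PMap

/-! ### Normal operators and their spectral projectors -/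

section Normal

variable (𝕜 Y : Type*) [RCLike 𝕜] [NormedAddCommGroup Y] [InnerProductSpace 𝕜 Y] [CompleteSpace Y]

/-- A (possibly unbounded) normal operator on a Hilbert space: densely defined, closed, and
`A A* = A* A`, where both products carry their natural domains. -/
structure NormalOperator where
  op : Y →ₗ.[𝕜] Y
  dense : Dense (op.domain : Set Y)
  closed : op.IsClosed
  normal : pcomp op op† = pcomp op† op

variable {𝕜 Y}

namespace NormalOperator

variable (A : NormalOperator 𝕜 Y)

/-- `A* A = |A| ^ 2`. -/
def absSq : Y →ₗ.[𝕜] Y := pcomp A.op† A.op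

/-- The spectral subspace of `A` that belongs to the closed disc `{λ | |λ| ≤ r}`: all `x` with
`‖|A| ^ (2 n) x‖ ≤ C r ^ (2 n)` for some `C` and all `n`.
If `μ` is the spectral measure of `A` at `x`, this says `∫ |λ| ^ (4 n) dμ ≤ C ^ 2 r ^ (4 n)` for
all `n`, and that holds for some `C` if and only if `μ {λ | r < |λ|} = 0`, which is to say that `x`
lies in the range of the spectral projector onto `{λ ∈ spec A | |λ| ≤ r}`. -/
def specSubspace (r : ℝ) : Submodule 𝕜 Y where
  carrier := {x | ∃ C : ℝ, ∀ n : ℕ, ∃ h : x ∈ (ppow A.absSq n).domain,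
    ‖ppow A.absSq n ⟨x, h⟩‖ ≤ C * r ^ (2 * n)}
  zero_mem' := ⟨0, fun n => ⟨Submodule.zero_mem _, by
    have : ppow A.absSq n ⟨0, Submodule.zero_mem _⟩ = 0 := LinearPMap.map_zero _
    simp [this]⟩⟩
  add_mem' := by
    rintro x y ⟨C, hC⟩ ⟨C', hC'⟩
    refine ⟨C + C', fun n => ?_⟩
    obtain ⟨h, hn⟩ := hC n
    obtain ⟨h', hn'⟩ := hC' n
    refine ⟨Submodule.add_mem _ h h', ?_⟩
    have : ppow A.absSq n ⟨x + y, Submodule.add_mem _ h h'⟩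
        = ppow A.absSq n ⟨x, h⟩ + ppow A.absSq n ⟨y, h'⟩ :=
      LinearPMap.map_add _ ⟨x, h⟩ ⟨y, h'⟩
    rw [this, add_mul]
    exact (norm_add_le _ _).trans (add_le_add hn hn')
  smul_mem' := by
    rintro c x ⟨C, hC⟩
    refine ⟨‖c‖ * C, fun n => ?_⟩
    obtain ⟨h, hn⟩ := hC n
    refine ⟨Submodule.smul_mem _ c h, ?_⟩
    have : ppow A.absSq n ⟨c • x, Submodule.smul_mem _ c h⟩ = c • ppow A.absSq n ⟨x, h⟩ :=
      LinearPMap.map_smul _ c ⟨x, h⟩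
    rw [this, norm_smul, mul_assoc]
    exact mul_le_mul_of_nonneg_left hn (norm_nonneg _)

/-- The spectral projector of `A` onto `{λ ∈ spec A | |λ| ≤ r}`: the orthogonal projection onto
the spectral subspace of the disc (which is closed; the closure is only taken in order to have
the projection at hand). -/
def specProj (r : ℝ) : Y →L[𝕜] Y := (A.specSubspace r).topologicalClosure.starProjection

/-! #### Elementary facts, needed for the scale of Hilbert spaces -/

theorem mem_absSq {x : Y} : x ∈ A.absSq.domain ↔
    ∃ h : x ∈ A.op.domain, A.op ⟨x, h⟩ ∈ A.op†.domain := mem_pcomp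

theorem inner_absSq {x y : Y} (hx : x ∈ A.absSq.domain) (hxA : x ∈ A.op.domain)
    (hy : y ∈ A.op.domain) :
    inner 𝕜 (A.absSq ⟨x, hx⟩) y = inner 𝕜 (A.op ⟨x, hxA⟩) (A.op ⟨y, hy⟩) := by
  obtain ⟨_, h'⟩ := A.mem_absSq.1 hx
  exact LinearPMap.adjoint_isFormalAdjoint A.dense ⟨_, h'⟩ ⟨y, hy⟩

theorem absSq_symm {x y : Y} (hx : x ∈ A.absSq.domain) (hy : y ∈ A.absSq.domain) :
    inner 𝕜 (A.absSq ⟨x, hx⟩) y = inner 𝕜 x (A.absSq ⟨y, hy⟩) := by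
  obtain ⟨hxA, _⟩ := A.mem_absSq.1 hx
  obtain ⟨hyA, _⟩ := A.mem_absSq.1 hy
  rw [A.inner_absSq hx hxA hyA, ← inner_conj_symm x, A.inner_absSq hy hyA hxA, inner_conj_symm]

/-- `A* A = A A*` on elements, with the domains. -/
theorem normal_apply {x : Y} (hx : x ∈ A.absSq.domain) :
    ∃ (h : x ∈ A.op†.domain) (h' : A.op† ⟨x, h⟩ ∈ A.op.domain),
      A.op ⟨A.op† ⟨x, h⟩, h'⟩ = A.absSq ⟨x, hx⟩ := by
  have hx' : x ∈ (pcomp A.op A.op†).domain := by rw [A.normal]; exact hx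
  obtain ⟨h, h'⟩ := mem_pcomp.1 hx'
  refine ⟨h, h', ?_⟩
  have key : ∀ (f g : Y →ₗ.[𝕜] Y) (_ : f = g) (h1 : x ∈ f.domain) (h2 : x ∈ g.domain),
      f ⟨x, h1⟩ = g ⟨x, h2⟩ := by rintro f _ rfl _ _; rfl
  exact key _ _ A.normal hx' hx

theorem mem_absSq_iff' {x : Y} : x ∈ A.absSq.domain ↔
    ∃ h : x ∈ A.op†.domain, A.op† ⟨x, h⟩ ∈ A.op.domain := by
  rw [← mem_pcomp, A.normal]; rfl

/-- `A` commutes with `A* A`. -/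
theorem absSq_comm {x : Y} (hx : x ∈ A.absSq.domain) (hA : x ∈ A.op.domain)
    (hHx : A.absSq ⟨x, hx⟩ ∈ A.op.domain) :
    ∃ h : A.op ⟨x, hA⟩ ∈ A.absSq.domain,
      A.absSq ⟨A.op ⟨x, hA⟩, h⟩ = A.op ⟨A.absSq ⟨x, hx⟩, hHx⟩ := by
  obtain ⟨_, h2⟩ := A.mem_absSq.1 hx
  have h : A.op ⟨x, hA⟩ ∈ A.absSq.domain := A.mem_absSq_iff'.2 ⟨h2, hHx⟩
  obtain ⟨_, _, h5⟩ := A.normal_apply h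
  exact ⟨h, h5.symm⟩

theorem ppow_absSq_comm (n : ℕ) : ∀ {x : Y} (_ : x ∈ (ppow A.absSq (n + 1)).domain)
    (hA : x ∈ A.op.domain) (hn : x ∈ (ppow A.absSq n).domain),
    ∃ (h : A.op ⟨x, hA⟩ ∈ (ppow A.absSq n).domain) (h' : ppow A.absSq n ⟨x, hn⟩ ∈ A.op.domain),
      ppow A.absSq n ⟨A.op ⟨x, hA⟩, h⟩ = A.op ⟨ppow A.absSq n ⟨x, hn⟩, h'⟩ := by
  induction n with
  | zero => intro x _ hA _; exact ⟨trivial, hA, rfl⟩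
  | succ n ih =>
    intro x hx hA hn
    obtain ⟨h1, h2⟩ := mem_ppow_succ.1 hx
    obtain ⟨_, h3⟩ := mem_ppow_succ.1 hn
    have hHA : A.absSq ⟨x, h1⟩ ∈ A.op.domain :=
      (A.mem_absSq.1 (mem_ppow_succ.1 h2).1).1
    obtain ⟨h4, h5⟩ := A.absSq_comm h1 hA hHA
    obtain ⟨h6, h7, h8⟩ := ih h2 hHA h3
    have h6' : A.absSq ⟨A.op ⟨x, hA⟩, h4⟩ ∈ (ppow A.absSq n).domain := by rw [h5]; exact h6
    refine ⟨mem_ppow_succ.2 ⟨h4, h6'⟩, h7, ?_⟩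
    have e : ppow A.absSq n ⟨A.absSq ⟨A.op ⟨x, hA⟩, h4⟩, h6'⟩
        = ppow A.absSq n ⟨A.op ⟨A.absSq ⟨x, h1⟩, hHA⟩, h6⟩ := by
      congr 1; exact Subtype.ext h5
    exact e.trans h8

theorem norm_sq_le_of_log_convex {a : ℕ → ℝ} (h0 : ∀ n, 0 ≤ a n)
    (hlc : ∀ n, a (n + 1) ^ 2 ≤ a n * a (n + 2)) {C s : ℝ} (hs : 0 ≤ s)
    (hC : ∀ n, a n ≤ C * s ^ n) : a 1 ≤ s * a 0 := by
  by_contra! hlt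
  have ha0 : 0 < a 0 := by
    rcases (h0 0).lt_or_eq with h | h
    · exact h
    · have := hlc 0
      rw [← h] at this hlt
      nlinarith
  have hq : s < a 1 / a 0 := by rwa [lt_div_iff₀ ha0]
  set q := a 1 / a 0 with hqd
  have hq0 : 0 < q := lt_of_le_of_lt hs hq
  have hstep : ∀ n, 0 < a n ∧ q * a n ≤ a (n + 1) := by
    intro n
    induction n with
    | zero => exact ⟨ha0, by rw [hqd]; field_simp; simp⟩
    | succ n ih =>
      obtain ⟨hn, hn'⟩ := ih
      have hn1 : 0 < a (n + 1) := lt_of_lt_of_le (by positivity) hn'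
      refine ⟨hn1, ?_⟩
      have h1 := hlc n
      have h2 : a (n + 1) * (q * a n) ≤ a (n + 1) * a (n + 1) :=
        mul_le_mul_of_nonneg_left hn' hn1.le
      have h3 : a n * (q * a (n + 1)) ≤ a n * a (n + 2) := by nlinarith
      exact le_of_mul_le_mul_left h3 hn
  have hgrow : ∀ n, a 0 * q ^ n ≤ a n := by
    intro n
    induction n with
    | zero => simp
    | succ n ih =>
      calc a 0 * q ^ (n + 1) = q * (a 0 * q ^ n) := by ring
        _ ≤ q * a n := mul_le_mul_of_nonneg_left ih hq0.le
        _ ≤ _ := (hstep n).2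
  rcases hs.lt_or_eq with hs | hs
  · have h1 : 1 < q / s := by rwa [one_lt_div hs]
    obtain ⟨n, hn⟩ := pow_unbounded_of_one_lt (C / a 0) h1
    rw [div_pow, div_lt_div_iff₀ ha0 (by positivity)] at hn
    have := (hgrow n).trans (hC n)
    linarith
  · have := hC 1
    rw [← hs] at this
    have h2 := hgrow 1
    have : 0 < a 0 * q ^ 1 := by positivity
    simp at *
    linarith

theorem absSq_mem_specSubspace {r : ℝ} {x : Y} (hx : x ∈ A.specSubspace r) :
    ∃ h : x ∈ A.absSq.domain, A.absSq ⟨x, h⟩ ∈ A.specSubspace r := by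
  obtain ⟨C, hC⟩ := hx
  obtain ⟨h, _⟩ := mem_ppow_succ.1 (hC 1).1
  refine ⟨h, C * r ^ 2, fun n => ?_⟩
  obtain ⟨h1, h2⟩ := hC (n + 1)
  refine ⟨(mem_ppow_succ.1 h1).2, ?_⟩
  have e : C * r ^ 2 * r ^ (2 * n) = C * r ^ (2 * (n + 1)) := by ring
  rw [e]
  exact h2

theorem norm_absSq_log_convex {x : Y} (h1 : x ∈ A.absSq.domain)
    (h2 : A.absSq ⟨x, h1⟩ ∈ A.absSq.domain) :
    ‖A.absSq ⟨x, h1⟩‖ ^ 2 ≤ ‖x‖ * ‖A.absSq ⟨A.absSq ⟨x, h1⟩, h2⟩‖ := by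
  rw [← inner_self_eq_norm_sq (𝕜 := 𝕜), A.absSq_symm h1 h2]
  exact re_inner_le_norm _ _

/-- The iterates of `A* A` at a point of the spectral subspace. -/
theorem norm_absSq_le {r : ℝ} {x : Y} (hx : x ∈ A.specSubspace r) (h : x ∈ A.absSq.domain) :
    ‖A.absSq ⟨x, h⟩‖ ≤ r ^ 2 * ‖x‖ := by
  let F : A.specSubspace r → A.specSubspace r := fun y =>
    ⟨A.absSq ⟨y.1, (A.absSq_mem_specSubspace y.2).1⟩, (A.absSq_mem_specSubspace y.2).2⟩
  have hF : ∀ (n : ℕ) (y : A.specSubspace r) (hn : y.1 ∈ (ppow A.absSq n).domain),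
      ((F^[n] y : A.specSubspace r) : Y) = ppow A.absSq n ⟨y.1, hn⟩ := by
    intro n
    induction n with
    | zero => intro y _; rfl
    | succ n ih =>
      intro y hn
      exact ih (F y) (mem_ppow_succ.1 hn).2
  obtain ⟨C, hC⟩ := hx
  have key := norm_sq_le_of_log_convex (a := fun n => ‖((F^[n] ⟨x, C, hC⟩ : A.specSubspace r) : Y)‖)
    (C := C) (s := r ^ 2) (fun n => norm_nonneg _) (fun n => by
      simp only [Function.iterate_succ_apply']
      exact A.norm_absSq_log_convex _ _) (sq_nonneg r) (fun n => by
      obtain ⟨h1, h2⟩ := hC n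
      rw [hF n ⟨x, C, hC⟩ h1, ← pow_mul]
      exact h2)
  exact key

theorem op_mem_specSubspace {r : ℝ} {x : Y} (hx : x ∈ A.specSubspace r) :
    ∃ h : x ∈ A.op.domain, A.op ⟨x, h⟩ ∈ A.specSubspace r ∧ ‖A.op ⟨x, h⟩‖ ≤ |r| * ‖x‖ := by
  have bound : ∀ y ∈ A.specSubspace r, ∀ h : y ∈ A.op.domain, ‖A.op ⟨y, h⟩‖ ≤ |r| * ‖y‖ := by
    intro y hy h
    obtain ⟨hH, _⟩ := A.absSq_mem_specSubspace hy
    have h1 : ‖A.op ⟨y, h⟩‖ ^ 2 ≤ (|r| * ‖y‖) ^ 2 := by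
      rw [← inner_self_eq_norm_sq (𝕜 := 𝕜), ← A.inner_absSq hH h h, mul_pow, sq_abs]
      calc _ ≤ ‖A.absSq ⟨y, hH⟩‖ * ‖y‖ := re_inner_le_norm _ _
        _ ≤ r ^ 2 * ‖y‖ * ‖y‖ :=
          mul_le_mul_of_nonneg_right (A.norm_absSq_le hy hH) (norm_nonneg _)
        _ = _ := by ring
    exact (sq_le_sq₀ (norm_nonneg _) (by positivity)).1 h1
  obtain ⟨hH, _⟩ := A.absSq_mem_specSubspace hx
  obtain ⟨hA, _⟩ := A.mem_absSq.1 hH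
  refine ⟨hA, ?_, bound x hx hA⟩
  have hpow : ∀ (n : ℕ) (y : Y) (_ : y ∈ A.specSubspace r) (hn : y ∈ (ppow A.absSq n).domain),
      ppow A.absSq n ⟨y, hn⟩ ∈ A.specSubspace r := by
    intro n
    induction n with
    | zero => intro y hy _; exact hy
    | succ n ih =>
      intro y hy hn
      exact ih _ (A.absSq_mem_specSubspace hy).2 (mem_ppow_succ.1 hn).2
  obtain ⟨C, hC⟩ := id hx
  refine ⟨|r| * C, fun n => ?_⟩
  obtain ⟨h1, h2⟩ := hC n
  obtain ⟨h3, h4, h5⟩ := A.ppow_absSq_comm n (hC (n + 1)).1 hA h1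
  refine ⟨h3, ?_⟩
  rw [h5, mul_assoc]
  exact (bound _ (hpow n x hx h1) h4).trans (mul_le_mul_of_nonneg_left h2 (abs_nonneg r))

theorem op_mem_closure {r : ℝ} {x : Y} (hx : x ∈ (A.specSubspace r).topologicalClosure) :
    ∃ h : x ∈ A.op.domain, A.op ⟨x, h⟩ ∈ (A.specSubspace r).topologicalClosure := by
  obtain ⟨u, hu, hux⟩ := mem_closure_iff_seq_limit.1
    (show x ∈ closure (A.specSubspace r : Set Y) from hx)
  have hd : ∀ n, u n ∈ A.op.domain := fun n => (A.op_mem_specSubspace (hu n)).1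
  have hdist : ∀ n m, dist (A.op ⟨u n, hd n⟩) (A.op ⟨u m, hd m⟩) ≤ |r| * dist (u n) (u m) := by
    intro n m
    rw [dist_eq_norm, dist_eq_norm, ← LinearPMap.map_sub]
    exact (A.op_mem_specSubspace (Submodule.sub_mem _ (hu n) (hu m))).2.2
  have hcau : CauchySeq fun n => A.op ⟨u n, hd n⟩ := by
    rw [Metric.cauchySeq_iff]
    intro ε hε
    obtain ⟨N, hN⟩ := Metric.cauchySeq_iff.1 hux.cauchySeq (ε / (|r| + 1)) (by positivity)
    refine ⟨N, fun m hm n hn => (hdist m n).trans_lt ?_⟩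
    have h1 := hN m hm n hn
    rw [lt_div_iff₀ (by positivity)] at h1
    nlinarith [dist_nonneg (x := u m) (y := u n)]
  obtain ⟨y, hy⟩ := cauchySeq_tendsto_of_complete hcau
  have hg : (x, y) ∈ A.op.graph := by
    refine A.closed.mem_of_tendsto (hux.prodMk_nhds hy) (Eventually.of_forall fun n => ?_)
    exact A.op.mem_graph ⟨u n, hd n⟩
  obtain ⟨z, hz1, hz2⟩ := (LinearPMap.mem_graph_iff _).1 hg
  simp only at hz1 hz2
  subst hz1
  refine ⟨z.2, ?_⟩
  have : A.op ⟨z.1, z.2⟩ = y := hz2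
  rw [this]
  exact mem_closure_of_tendsto hy
    (Eventually.of_forall fun n => (A.op_mem_specSubspace (hu n)).2.1)

theorem closure_le_domain (r : ℝ) (l : ℕ) :
    (A.specSubspace r).topologicalClosure ≤ (ppow A.op l).domain := by
  induction l with
  | zero => intro x _; trivial
  | succ l ih =>
    intro x hx
    obtain ⟨h, h'⟩ := A.op_mem_closure hx
    exact mem_ppow_succ.2 ⟨h, ih h'⟩

theorem specProj_mem (r : ℝ) (l : ℕ) (x : Y) : A.specProj r x ∈ (ppow A.op l).domain :=
  A.closure_le_domain r l (Submodule.starProjection_apply_mem _ x)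

theorem op_eq_zero_of_ppow (l : ℕ) : ∀ {x : Y} (hx : x ∈ (ppow A.op l).domain),
    ppow A.op l ⟨x, hx⟩ = 0 → ∃ h : x ∈ A.op.domain, A.op ⟨x, h⟩ = 0 := by
  induction l with
  | zero =>
    intro x _ h0
    have hx0 : x = 0 := h0
    subst hx0
    exact ⟨Submodule.zero_mem _, LinearPMap.map_zero _⟩
  | succ l ih =>
    intro x hx h0
    obtain ⟨h, h'⟩ := mem_ppow_succ.1 hx
    refine ⟨h, ?_⟩
    obtain ⟨k, k'⟩ := ih h' h0
    set y := A.op ⟨x, h⟩ with hy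
    have hyH : y ∈ A.absSq.domain := A.mem_absSq.2 ⟨k, by rw [k']; exact Submodule.zero_mem _⟩
    have hy0 : A.absSq ⟨y, hyH⟩ = 0 := by
      have hz : A.op ⟨y, k⟩ ∈ A.op†.domain := by rw [k']; exact Submodule.zero_mem _
      have e : A.absSq ⟨y, hyH⟩ = A.op† ⟨A.op ⟨y, k⟩, hz⟩ := rfl
      have e2 : (⟨A.op ⟨y, k⟩, hz⟩ : A.op†.domain) = 0 := Subtype.ext k'
      rw [e, e2, LinearPMap.map_zero]
    obtain ⟨p, q, hpq⟩ := A.normal_apply hyH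
    have hadj := LinearPMap.adjoint_isFormalAdjoint A.dense ⟨y, p⟩ ⟨_, q⟩
    simp only [] at hadj
    rw [hpq, hy0, inner_zero_right, inner_self_eq_zero] at hadj
    have hadj2 := LinearPMap.adjoint_isFormalAdjoint A.dense ⟨y, p⟩ ⟨x, h⟩
    rw [hadj, inner_zero_left, ← hy] at hadj2
    exact inner_self_eq_zero.1 hadj2.symm

theorem mem_specSubspace_of_op_eq_zero {r : ℝ} {x : Y} (h : x ∈ A.op.domain)
    (h0 : A.op ⟨x, h⟩ = 0) : x ∈ A.specSubspace r := by
  have hz : A.op ⟨x, h⟩ ∈ A.op†.domain := by rw [h0]; exact Submodule.zero_mem _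
  have hH : x ∈ A.absSq.domain := A.mem_absSq.2 ⟨h, hz⟩
  have hH0 : A.absSq ⟨x, hH⟩ = 0 := by
    have e : A.absSq ⟨x, hH⟩ = A.op† ⟨A.op ⟨x, h⟩, hz⟩ := rfl
    have e2 : (⟨A.op ⟨x, h⟩, hz⟩ : A.op†.domain) = 0 := Subtype.ext h0
    rw [e, e2, LinearPMap.map_zero]
  refine ⟨‖x‖, fun n => ?_⟩
  cases n with
  | zero => exact ⟨mem_ppow_zero _ _, by rw [ppow_zero_apply]; simp⟩
  | succ n =>
    have hm : A.absSq ⟨x, hH⟩ ∈ (ppow A.absSq n).domain := by rw [hH0]; exact Submodule.zero_mem _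
    refine ⟨mem_ppow_succ.2 ⟨hH, hm⟩, ?_⟩
    have e : ppow A.absSq (n + 1) ⟨x, mem_ppow_succ.2 ⟨hH, hm⟩⟩
        = ppow A.absSq n ⟨A.absSq ⟨x, hH⟩, hm⟩ := rfl
    have e2 : (⟨A.absSq ⟨x, hH⟩, hm⟩ : (ppow A.absSq n).domain) = 0 := Subtype.ext hH0
    rw [e, e2, LinearPMap.map_zero, norm_zero, pow_mul]
    positivity

/-! ### The scale of Hilbert spaces -/

/-- The underlying vector space `D(A ^ l)` of the `l`-th space of the scale. -/
def Scale (l : ℕ) : Type _ := (ppow A.op l).domain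

variable {A} {l : ℕ}

instance : AddCommGroup (A.Scale l) := inferInstanceAs (AddCommGroup (ppow A.op l).domain)

instance : Module 𝕜 (A.Scale l) := inferInstanceAs (Module 𝕜 (ppow A.op l).domain)

namespace Scale

/-- The inclusion of the `l`-th space of the scale into `Y`. -/
def val : A.Scale l →ₗ[𝕜] Y := (ppow A.op l).domain.subtype

theorem val_mem (x : A.Scale l) : val x ∈ (ppow A.op l).domain := Subtype.property _

theorem val_injective : Function.Injective (val : A.Scale l →ₗ[𝕜] Y) := Subtype.val_injective

/-- A vector of `D(A ^ l)` as an element of the `l`-th space of the scale. -/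
def mk (x : Y) (h : x ∈ (ppow A.op l).domain) : A.Scale l := ⟨x, h⟩

/-- The inclusion of the `l`-th space of the scale into the `k`-th one, `k ≤ l`. -/
def incl {k : ℕ} (h : k ≤ l) : A.Scale l →ₗ[𝕜] A.Scale k :=
  Submodule.inclusion (ppow_domain_le A.op h)

/-- `U ↦ P U`, where `P` is the spectral projector of `A` onto `{λ ∈ spec A | |λ| ≤ 1}`. -/
def lowPart : A.Scale l →ₗ[𝕜] Y := (A.specProj 1 : Y →ₗ[𝕜] Y) ∘ₗ val

theorem high_mem (x : A.Scale l) : val x - A.specProj 1 (val x) ∈ (ppow A.op l).domain :=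
  Submodule.sub_mem _ (val_mem x) (A.specProj_mem 1 l _)

/-- `U ↦ A ^ l Q U`, where `Q = 1 - P`. -/
def highPart : A.Scale l →ₗ[𝕜] Y :=
  (ppow A.op l).toFun ∘ₗ
    LinearMap.codRestrict (ppow A.op l).domain (val - lowPart) high_mem

theorem eq_zero_of_parts {x : A.Scale l} (h1 : lowPart x = 0) (h2 : highPart x = 0) : x = 0 := by
  have hx : A.specProj 1 (val x) = 0 := h1
  have e : (⟨val x - A.specProj 1 (val x), high_mem x⟩ : (ppow A.op l).domain)
      = ⟨val x, val_mem x⟩ := Subtype.ext (by simp [hx])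
  have h3 : ppow A.op l ⟨val x - A.specProj 1 (val x), high_mem x⟩ = 0 := h2
  rw [e] at h3
  obtain ⟨h, h0⟩ := A.op_eq_zero_of_ppow l _ h3
  have hmem : val x ∈ (A.specSubspace 1).topologicalClosure :=
    Submodule.le_topologicalClosure _ (A.mem_specSubspace_of_op_eq_zero h h0)
  have h4 : A.specProj 1 (val x) = val x := Submodule.starProjection_eq_self_iff.2 hmem
  exact val_injective (by rw [← h4, hx, map_zero])

/-- The scalar product
`⟨U, V⟩_l = ⟨P U, P V⟩ + ⟨|A| ^ l Q U, |A| ^ l Q V⟩` on `D(A ^ l)`; as `A` is normal,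
`⟨|A| ^ l X, |A| ^ l Z⟩ = ⟨A ^ l X, A ^ l Z⟩` for all `X, Z` in `D(A ^ l) = D(|A| ^ l)`. -/
instance instCore : InnerProductSpace.Core 𝕜 (A.Scale l) where
  inner x y := inner 𝕜 (lowPart x) (lowPart y) + inner 𝕜 (highPart x) (highPart y)
  conj_inner_symm x y := by simp [inner_conj_symm]
  re_inner_nonneg x := by
    rw [map_add]
    exact add_nonneg inner_self_nonneg inner_self_nonneg
  add_left x y z := by simp only [map_add, inner_add_left]; ring
  smul_left x y r := by simp only [map_smul, inner_smul_left]; ring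
  definite x h := by
    have h' := congrArg RCLike.re h
    simp only [map_add, map_zero, inner_self_eq_norm_sq] at h'
    have h1 : ‖lowPart x‖ = 0 := by nlinarith [norm_nonneg (lowPart x), sq_nonneg ‖highPart x‖]
    have h2 : ‖highPart x‖ = 0 := by nlinarith [norm_nonneg (highPart x), sq_nonneg ‖lowPart x‖]
    exact eq_zero_of_parts (norm_eq_zero.1 h1) (norm_eq_zero.1 h2)

instance : NormedAddCommGroup (A.Scale l) :=
  InnerProductSpace.Core.toNormedAddCommGroup (𝕜 := 𝕜)

instance : InnerProductSpace 𝕜 (A.Scale l) := InnerProductSpace.ofCore instCore.toCore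

/-- The real structure; derivatives of the nonlinearity are real Fréchet derivatives. -/
instance : NormedSpace ℝ (A.Scale l) := NormedSpace.restrictScalars ℝ 𝕜 (A.Scale l)

theorem norm_sq (x : A.Scale l) : ‖x‖ ^ 2 = ‖lowPart x‖ ^ 2 + ‖highPart x‖ ^ 2 := by
  rw [← inner_self_eq_norm_sq (𝕜 := 𝕜) x]
  have : inner 𝕜 x x = inner 𝕜 (lowPart x) (lowPart x) + inner 𝕜 (highPart x) (highPart x) := rfl
  rw [this, map_add, inner_self_eq_norm_sq, inner_self_eq_norm_sq]

end Scale

end NormalOperator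

end Normal

/-! ### Semigroups -/

section Semigroup

variable {𝕜 Y : Type*} [RCLike 𝕜] [NormedAddCommGroup Y] [InnerProductSpace 𝕜 Y] [CompleteSpace Y]

/-- Strongly continuous semigroups; only the values `S t` with `0 ≤ t` matter. -/
structure IsC0Semigroup (S : ℝ → Y →L[𝕜] Y) : Prop where
  zero : S 0 = ContinuousLinearMap.id 𝕜 Y
  add : ∀ s t : ℝ, 0 ≤ s → 0 ≤ t → S (s + t) = (S s).comp (S t)
  continuous : ∀ x : Y, Tendsto (fun t => S t x) (𝓝[>] 0) (𝓝 x)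

/-- `A` is the infinitesimal generator of `S`: `x ∈ D(A)` and `A x = y` if and only if
`(S h x - x) / h → y` as `h ↓ 0`. -/
def IsGenerator (A : Y →ₗ.[𝕜] Y) (S : ℝ → Y →L[𝕜] Y) : Prop :=
  ∀ x y : Y, (x, y) ∈ A.graph ↔
    Tendsto (fun h : ℝ => ((h⁻¹ : ℝ) : 𝕜) • (S h x - x)) (𝓝[>] 0) (𝓝 y)

end Semigroup

/-! ### The class `C_b^n` -/

/-- `f ∈ C_b^n(s; F)` for an open set `s`: `f` is `n` times continuously differentiable on `s`, and
its derivatives of order `j = 0, …, n` are bounded on `s` by `M j` and extend continuously to the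
boundary of `s`. -/
structure IsCb {E F : Type*} [NormedAddCommGroup E] [NormedSpace ℝ E] [NormedAddCommGroup F]
    [NormedSpace ℝ F] (n : ℕ) (M : ℕ → ℝ) (f : E → F) (s : Set E) : Prop where
  contDiffOn : ContDiffOn ℝ n f s
  bound : ∀ j ≤ n, ∀ x ∈ s, ‖iteratedFDerivWithin ℝ j f s x‖ ≤ M j
  extends_boundary : ∀ j ≤ n, ∃ g : E → ContinuousMultilinearMap ℝ (fun _ : Fin j => E) F,
    ContinuousOn g (closure s) ∧ EqOn g (iteratedFDerivWithin ℝ j f s) s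

/-! ### The evolution equation and its Galerkin truncation -/

section Evolution

variable {𝕜 Y : Type*} [RCLike 𝕜] [NormedAddCommGroup Y] [InnerProductSpace 𝕜 Y] [CompleteSpace Y]

open scoped Classical in
/-- The map `D(A ^ k) → D(A ^ k)` induced by `B`, with the value `0` where `B` does not take values
in `D(A ^ k)`. -/
def onScale (A : NormalOperator 𝕜 Y) (B : Y → Y) (k : ℕ) (x : A.Scale k) : A.Scale k :=
  if h : B x.val ∈ (ppow A.op k).domain then NormalOperator.Scale.mk (B x.val) h else 0

/-- The condition on the nonlinearity `B` (only its values on `D 0` matter), on the first `K + 1`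
rungs of the scale: the sets `D k` in the `k`-th space are nested, bounded and open, `B` maps `D k`
to the `k`-th space, and is of class `C_b^(N - k)` there; `M k j` bounds the `j`-th derivative of
`B` on `D k`. -/
structure NonlinearityCondition (A : NormalOperator 𝕜 Y) (B : Y → Y)
    (D : (k : ℕ) → Set (A.Scale k)) (K N : ℕ) (M : ℕ → ℕ → ℝ) : Prop where
  isOpen : ∀ k ≤ K, IsOpen (D k)
  isBounded : ∀ k ≤ K, Bornology.IsBounded (D k)
  nested : ∀ k < K, ∀ x ∈ D (k + 1), x.incl k.le_succ ∈ D k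
  mapsTo : ∀ k ≤ K, ∀ x ∈ D k, B x.val ∈ (ppow A.op k).domain
  cb : ∀ k ≤ K, IsCb (N - k) (M k) (onScale A B k) (D k)

/-- The set `D_l^{-δ}` of all points of `D l` whose distance to the boundary of `D j`, in the norm
of the `j`-th space, exceeds `δ` for `j = 0, …, l` (the distance to the empty set being `∞`). -/
def shrink {A : NormalOperator 𝕜 Y} (D : (k : ℕ) → Set (A.Scale k)) (δ : ℝ) (l : ℕ) :
    Set (A.Scale l) :=
  {x | x ∈ D l ∧ ∀ (j : ℕ) (h : j ≤ l),
    ENNReal.ofReal δ < Metric.infEDist (x.incl h) (frontier (D j))}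

/-- Mild solutions of `dU/dt = A U + B(U)` on `[0, T]`, where `S t = exp (t A)`. -/
def IsMildSolution [NormedSpace ℝ Y] (S : ℝ → Y →L[𝕜] Y) (B : Y → Y) (T : ℝ) (U : ℝ → Y) : Prop :=
  ∀ t ∈ Icc 0 T, U t = S t (U 0) + ∫ s in (0 : ℝ)..t, S (t - s) (B (U s))

/-- Solutions on `[0, T]` of the projected system `du/dt = A u + P_m B(u)`, `u(0) = P_m U₀`, in the
range of the spectral projector `P_m` of `A` onto `{λ ∈ spec A | |λ| ≤ m}`. -/
structure IsProjectedSolution [NormedSpace ℝ Y] (A : NormalOperator 𝕜 Y) (B : Y → Y) (m : ℕ)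
    (T : ℝ) (U₀ : Y) (u : ℝ → Y) : Prop where
  initial : u 0 = A.specProj m U₀
  proj : ∀ t ∈ Icc 0 T, A.specProj m (u t) = u t
  ode : ∀ t ∈ Icc 0 T, ∃ h : u t ∈ A.op.domain,
    HasDerivWithinAt u (A.op ⟨u t, h⟩ + A.specProj m (B (u t))) (Icc 0 T) t

end Evolution

end Galerkin

end

open Galerkin

noncomputable section

/-! Put p = P_m U and w = u_m - p, so that the error is U - u_m = (U - p) - w. The tail U - p has
norm at most R / m ^ (K + 1 - k) in the k-th space, because A is bounded below by m on the
orthogonal complement of the range of P_m (`pow_mul_norm_incl_sub_toScale_le`). Since U takes values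
in D(A), the mild solution has right derivative A U + B(U); hence p' = A p + P_m B(U) and w' = A w +
P_m (B(u_m) - B(U)).

The growth bound of the semigroup gives re ⟨A x, x⟩ ≤ ω ‖x‖ ^ 2, also in the k-th scalar product, as
A commutes with the maps that define it. There P_m is a contraction and B is Lipschitz on balls, so
Grönwall's inequality bounds w by a multiple of the tail (`norm_le_of_energy`). For k = 0 this is
the asserted rate. For k = K it says that w is of order 1 / m, so for large m the approximation
stays in the δ-tube around U, where B is under control. No continuation argument is needed: the
equation is first solved with its argument retracted radially to a tube around p
(`exists_truncated_solution`), and the bound for k = K then shows that the retraction never acts.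

The spectral input is the single inequality r ‖x‖ ≤ ‖A x‖ on the complement of the spectral subspace
(`le_norm_op_of_orthogonal`), obtained over ℝ and ℂ alike without a spectral measure. Let t be the
inverse of 1 + A* A and τ = 1 / (1 + r ^ 2). A square root defined by a power series splits the
space by the sign of t - τ. On the nonnegative part A* A is bounded by r ^ 2, so that part lies in
the spectral subspace; on the orthogonal complement of the spectral subspace the form of t is
therefore at most τ, and Cauchy–Schwarz in the graph scalar product turns this into the lower bound
for A. -/

namespace Galerkin

/-! ### Square roots of positive operators and the splitting of a symmetric operator -/

/-- The coefficients of `1 - √(1 - z) = ∑ c_n z ^ (n + 1)`. -/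
def sqrtCoeff (n : ℕ) : ℝ := 2 * catalan n / 4 ^ (n + 1)

theorem sqrtCoeff_nonneg (n : ℕ) : 0 ≤ sqrtCoeff n := by unfold sqrtCoeff; positivity

theorem sqrtCoeff_zero : sqrtCoeff 0 = 1 / 2 := by norm_num [sqrtCoeff]

/-- This is the Catalan recursion. In terms of y = 1 - √(1 - z) it compares coefficients in y ^ 2 =
2 y - z. -/
theorem sum_antidiagonal_sqrtCoeff (n : ℕ) :
    ∑ p ∈ Finset.HasAntidiagonal.antidiagonal n, sqrtCoeff p.1 * sqrtCoeff p.2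
      = 2 * sqrtCoeff (n + 1) := by
  have h : ∀ p ∈ Finset.HasAntidiagonal.antidiagonal n, sqrtCoeff p.1 * sqrtCoeff p.2
      = 4 / 4 ^ (n + 2) * ((catalan p.1 * catalan p.2 : ℕ) : ℝ) := by
    intro p hp
    have e : n + 2 = (p.1 + 1) + (p.2 + 1) := by
      have := Finset.HasAntidiagonal.mem_antidiagonal.1 hp
      omega
    rw [e, pow_add, sqrtCoeff, sqrtCoeff]
    push_cast
    field_simp
    ring
  rw [Finset.sum_congr rfl h, ← Finset.mul_sum, ← Nat.cast_sum, ← catalan_succ', sqrtCoeff]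
  ring

/-- If s_n is the partial sum, the recursion gives s_{n+1} ≤ 1/2 + s_n ^ 2 / 2, since the
antidiagonals below n are disjoint subsets of the square of side n; so the bound 1 propagates. It
makes the power series converge on the whole closed unit ball. -/
theorem sum_sqrtCoeff_le (n : ℕ) : ∑ i ∈ Finset.range n, sqrtCoeff i ≤ 1 := by
  induction n with
  | zero => simp
  | succ n ih =>
    have h0 : 0 ≤ ∑ i ∈ Finset.range n, sqrtCoeff i :=
      Finset.sum_nonneg fun i _ => sqrtCoeff_nonneg i
    have h1 : ∑ i ∈ Finset.range n, 2 * sqrtCoeff (i + 1)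
        ≤ (∑ i ∈ Finset.range n, sqrtCoeff i) * ∑ i ∈ Finset.range n, sqrtCoeff i := by
      simp_rw [← sum_antidiagonal_sqrtCoeff]
      rw [Finset.sum_mul_sum, ← Finset.sum_product', ← Finset.sum_biUnion]
      · refine Finset.sum_le_sum_of_subset_of_nonneg ?_ fun p _ _ =>
          mul_nonneg (sqrtCoeff_nonneg _) (sqrtCoeff_nonneg _)
        intro p hp
        obtain ⟨i, hi, hp⟩ := Finset.mem_biUnion.1 hp
        have := Finset.HasAntidiagonal.mem_antidiagonal.1 hp
        have := Finset.mem_range.1 hi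
        exact Finset.mem_product.2 ⟨Finset.mem_range.2 (by omega), Finset.mem_range.2 (by omega)⟩
      · intro i _ j _ hij
        refine Finset.disjoint_left.2 fun p hp hp' => hij ?_
        rw [← Finset.HasAntidiagonal.mem_antidiagonal.1 hp,
          ← Finset.HasAntidiagonal.mem_antidiagonal.1 hp']
    rw [← Finset.mul_sum] at h1
    rw [Finset.sum_range_succ', sqrtCoeff_zero]
    nlinarith

theorem summable_sqrtCoeff : Summable sqrtCoeff :=
  summable_of_sum_range_le sqrtCoeff_nonneg sum_sqrtCoeff_le

theorem tsum_sqrtCoeff_le : ∑' n, sqrtCoeff n ≤ 1 :=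
  summable_sqrtCoeff.tsum_le_of_sum_range_le sum_sqrtCoeff_le

/-! ### The square root series in a Banach algebra -/

section BanachAlgebra

variable {𝕜 R : Type*} [RCLike 𝕜] [NormedRing R] [NormedAlgebra 𝕜 R]

theorem norm_sqrtCoeff_smul_pow_le {a : R} (ha : ‖a‖ ≤ 1) (n : ℕ) :
    ‖(sqrtCoeff n : 𝕜) • a ^ (n + 1)‖ ≤ sqrtCoeff n := by
  rw [norm_smul, RCLike.norm_ofReal, abs_of_nonneg (sqrtCoeff_nonneg n)]
  refine mul_le_of_le_one_right (sqrtCoeff_nonneg n) ?_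
  exact (norm_pow_le' a n.succ_pos).trans (pow_le_one₀ (norm_nonneg _) ha)

variable (𝕜) in
theorem summable_norm_sqrtCoeff_smul_pow {a : R} (ha : ‖a‖ ≤ 1) :
    Summable fun n => ‖(sqrtCoeff n : 𝕜) • a ^ (n + 1)‖ :=
  Summable.of_nonneg_of_le (fun _ => norm_nonneg _) (norm_sqrtCoeff_smul_pow_le ha)
    summable_sqrtCoeff

variable [CompleteSpace R]

-- With y the sum of the series, the Cauchy product and the Catalan recursion give y ^ 2 = 2 y - a.
-- The case ‖a‖ = 1 is included, as the coefficients are summable.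
variable (𝕜) in
theorem one_sub_tsum_sq {a : R} (ha : ‖a‖ ≤ 1) :
    (1 - ∑' n, (sqrtCoeff n : 𝕜) • a ^ (n + 1)) * (1 - ∑' n, (sqrtCoeff n : 𝕜) • a ^ (n + 1))
      = 1 - a := by
  have hs := summable_norm_sqrtCoeff_smul_pow 𝕜 ha
  have hmul := tsum_mul_tsum_eq_tsum_sum_antidiagonal_of_summable_norm hs hs
  have hterm : ∀ n, ∑ p ∈ Finset.HasAntidiagonal.antidiagonal n,
      ((sqrtCoeff p.1 : 𝕜) • a ^ (p.1 + 1)) * ((sqrtCoeff p.2 : 𝕜) • a ^ (p.2 + 1))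
      = (2 : 𝕜) • ((sqrtCoeff (n + 1) : 𝕜) • a ^ (n + 1 + 1)) := by
    intro n
    have h : ∀ p ∈ Finset.HasAntidiagonal.antidiagonal n,
        ((sqrtCoeff p.1 : 𝕜) • a ^ (p.1 + 1)) * ((sqrtCoeff p.2 : 𝕜) • a ^ (p.2 + 1))
        = ((sqrtCoeff p.1 * sqrtCoeff p.2 : ℝ) : 𝕜) • a ^ (n + 2) := by
      intro p hp
      have e : n + 2 = (p.1 + 1) + (p.2 + 1) := by
        have := Finset.HasAntidiagonal.mem_antidiagonal.1 hp
        omega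
      rw [smul_mul_smul_comm, ← pow_add, ← e]
      push_cast
      rfl
    rw [Finset.sum_congr rfl h, ← Finset.sum_smul, ← RCLike.ofReal_sum,
      sum_antidiagonal_sqrtCoeff, smul_smul]
    push_cast
    rfl
  simp_rw [hterm] at hmul
  have hs' : Summable fun n => (sqrtCoeff n : 𝕜) • a ^ (n + 1) := hs.of_norm
  rw [tsum_const_smul'' (2 : 𝕜)] at hmul
  have h0 := hs'.tsum_eq_zero_add
  rw [sqrtCoeff_zero] at h0
  set y := ∑' n, (sqrtCoeff n : 𝕜) • a ^ (n + 1)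
  set z := ∑' n, (sqrtCoeff (n + 1) : 𝕜) • a ^ (n + 1 + 1)
  have h1 : (2 : 𝕜) • y = a + (2 : 𝕜) • z := by
    rw [h0, smul_add, smul_smul]
    push_cast
    norm_num
  have h2 : (2 : 𝕜) • y = y + y := two_smul _ _
  rw [sub_mul, mul_sub, mul_sub, one_mul, mul_one, one_mul, hmul]
  have h3 : (2 : 𝕜) • z = y + y - a := by rw [← h2, h1]; abel
  rw [h3]
  abel

end BanachAlgebra

/-! ### Symmetric operators: square root and sign -/

section Hilbert

variable {𝕜 E : Type*} [RCLike 𝕜] [NormedAddCommGroup E] [InnerProductSpace 𝕜 E]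

theorem inner_pow_apply {a : E →L[𝕜] E} (ha : ∀ x y, inner 𝕜 (a x) y = inner 𝕜 x (a y)) (n : ℕ) :
    ∀ x y, inner 𝕜 ((a ^ n) x) y = inner 𝕜 x ((a ^ n) y) := by
  induction n with
  | zero => simp
  | succ n ih =>
    intro x y
    rw [pow_succ, mul_apply_eq_comp, ih, ha, ← mul_apply_eq_comp,
      ← pow_succ', pow_succ]

variable [CompleteSpace E]

/-- The positive square root of a symmetric operator `s` with `‖1 - s‖ ≤ 1`. -/
theorem exists_sqrt {s : E →L[𝕜] E} (hs : ∀ x y, inner 𝕜 (s x) y = inner 𝕜 x (s y))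
    (h1 : ‖1 - s‖ ≤ 1) :
    ∃ q : E →L[𝕜] E, q * q = s ∧ (∀ x y, inner 𝕜 (q x) y = inner 𝕜 x (q y)) ∧
      (∀ x, 0 ≤ RCLike.re (inner 𝕜 (q x) x)) ∧ ∀ t, Commute s t → Commute q t := by
  set a := 1 - s with ha
  have hsum := (summable_norm_sqrtCoeff_smul_pow 𝕜 h1).of_norm
  set y := ∑' n, (sqrtCoeff n : 𝕜) • a ^ (n + 1) with hy
  have hasum : ∀ x, HasSum (fun n => (sqrtCoeff n : 𝕜) • (a ^ (n + 1)) x) (y x) := fun x =>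
    hsum.hasSum.mapL (ContinuousLinearMap.apply 𝕜 E x)
  have hasymm : ∀ x y, inner 𝕜 (a x) y = inner 𝕜 x (a y) := by
    intro x y
    simp [ha, inner_sub_left, inner_sub_right, hs]
  have hysymm : ∀ x z, inner 𝕜 (y x) z = inner 𝕜 x (y z) := by
    intro x z
    have e1 : HasSum (fun n => inner 𝕜 x ((sqrtCoeff n : 𝕜) • (a ^ (n + 1)) z))
        (inner 𝕜 x (y z)) := (hasum z).mapL (innerSL 𝕜 x)
    have e2 : HasSum (fun n => inner 𝕜 z ((sqrtCoeff n : 𝕜) • (a ^ (n + 1)) x))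
        (inner 𝕜 z (y x)) := (hasum x).mapL (innerSL 𝕜 z)
    rw [← inner_conj_symm (y x) z]
    have e3 := (RCLike.hasSum_conj' 𝕜).2 e2
    refine e3.unique ?_
    convert e1 using 2 with n
    simp only [inner_smul_right, map_mul, inner_conj_symm, RCLike.conj_ofReal]
    rw [inner_pow_apply hasymm]
  -- The coefficients sum to at most 1; this is what makes 1 - y positive.
  have hynorm : ‖y‖ ≤ 1 :=
    (tsum_of_norm_bounded summable_sqrtCoeff.hasSum (norm_sqrtCoeff_smul_pow_le h1)).trans
      tsum_sqrtCoeff_le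
  refine ⟨1 - y, ?_, ?_, ?_, ?_⟩
  · rw [hy, one_sub_tsum_sq 𝕜 h1, ha]; abel
  · intro x z
    simp [inner_sub_left, inner_sub_right, hysymm]
  · intro x
    simp only [sub_apply, one_apply_eq_self, inner_sub_left,
      map_sub, inner_self_eq_norm_sq]
    have e1 : RCLike.re (inner 𝕜 (y x) x) ≤ ‖y x‖ * ‖x‖ := re_inner_le_norm _ _
    have e2 : ‖y x‖ ≤ 1 * ‖x‖ := y.le_of_opNorm_le hynorm x
    nlinarith [norm_nonneg x]
  · intro t ht
    have hat : Commute a t := (Commute.one_left t).sub_left ht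
    refine (Commute.one_left t).sub_left ?_
    have e1 : y * t = ∑' n, ((sqrtCoeff n : 𝕜) • a ^ (n + 1)) * t := (hsum.tsum_mul_right t).symm
    have e2 : t * y = ∑' n, t * ((sqrtCoeff n : 𝕜) • a ^ (n + 1)) := (hsum.tsum_mul_left t).symm
    rw [Commute, SemiconjBy, e1, e2]
    congr 1
    ext1 n
    rw [smul_mul_assoc, mul_smul_comm, (hat.pow_left (n + 1)).eq]

/-- A symmetric operator `g` splits the space into a subspace on which it is nonnegative and the
orthogonal complement, on which it is nonpositive; the first one is invariant under all operators
that commute with `g`. -/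
theorem exists_sign_splitting {g : E →L[𝕜] E} (hg : ∀ x y, inner 𝕜 (g x) y = inner 𝕜 x (g y))
    (h1 : ‖g‖ ≤ 1) :
    ∃ W : Submodule 𝕜 E, IsClosed (W : Set E) ∧ (∀ t, Commute g t → ∀ x ∈ W, t x ∈ W) ∧
      (∀ x ∈ W, 0 ≤ RCLike.re (inner 𝕜 (g x) x)) ∧
      ∀ x ∈ Wᗮ, RCLike.re (inner 𝕜 (g x) x) ≤ 0 := by
  have hs : ∀ x y, inner 𝕜 ((g * g) x) y = inner 𝕜 x ((g * g) y) := by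
    intro x y
    simp [hg]
  have hn : ‖1 - g * g‖ ≤ 1 := by
    refine ContinuousLinearMap.opNorm_le_bound _ zero_le_one fun x => ?_
    rw [one_mul]
    refine (sq_le_sq₀ (norm_nonneg _) (norm_nonneg _)).1 ?_
    have e : (1 - g * g) x = x - g (g x) := by simp
    rw [e, norm_sub_sq (𝕜 := 𝕜), ← hg, inner_self_eq_norm_sq]
    have : ‖g (g x)‖ ≤ 1 * ‖g x‖ := g.le_of_opNorm_le h1 _
    nlinarith [norm_nonneg (g (g x)), norm_nonneg (g x)]
  -- Here q plays the part of |g|, and W is the kernel of |g| - g.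
  obtain ⟨q, hq, hqs, hqp, hqc⟩ := exists_sqrt hs hn
  have hgq : Commute q g := hqc g ((Commute.refl g).mul_left (Commute.refl g))
  refine ⟨(q - g).ker, (q - g).isClosed_ker, ?_, ?_, ?_⟩
  · intro t ht x hx
    have hx' : q x - g x = 0 := hx
    have e : q (t x) - g (t x) = t (q x - g x) := by
      rw [map_sub]
      have e1 := congrArg (fun f : E →L[𝕜] E => f x) (hqc t (ht.mul_left ht)).eq
      have e2 := congrArg (fun f : E →L[𝕜] E => f x) ht.eq
      simp only [mul_apply_eq_comp] at e1 e2
      rw [e1, e2]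
    show q (t x) - g (t x) = 0
    rw [e, hx', map_zero]
  · intro x hx
    have hx' : q x - g x = 0 := hx
    rw [← sub_eq_zero.1 hx']
    exact hqp x
  · intro x hx
    -- As (q - g)(q + g) = q ^ 2 - g ^ 2 = 0, the range of q + g lies in W. For x orthogonal to W
    -- this gives ‖(q + g) x‖ ^ 2 = ⟨(q + g)(q + g) x, x⟩ = 0, so g = -q at x.
    have h0 : (q + g) x = 0 := by
      rw [← inner_self_eq_zero (𝕜 := 𝕜)]
      have e : inner 𝕜 ((q + g) x) ((q + g) x) = inner 𝕜 ((q + g) ((q + g) x)) x := by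
        have h : ∀ u v, inner 𝕜 ((q + g) u) v = inner 𝕜 u ((q + g) v) := by
          intro u v
          simp [inner_add_left, inner_add_right, hqs, hg]
        rw [h ((q + g) x)]
      rw [e]
      refine (Submodule.mem_orthogonal _ _).1 hx _ ?_
      show (q - g) ((q + g) ((q + g) x)) = 0
      have e2 : (q - g) * (q + g) = 0 := by
        rw [sub_mul, mul_add, mul_add, hq, hgq.eq]; abel
      exact congrArg (fun f : E →L[𝕜] E => f ((q + g) x)) e2
    have h2 : g x = - q x := by
      rw [eq_neg_iff_add_eq_zero, add_comm]; exact h0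
    rw [h2, inner_neg_left, map_neg]
    linarith [hqp x]

end Hilbert

end Galerkin

namespace Galerkin.NormalOperator

variable {𝕜 Y : Type*} [RCLike 𝕜] [NormedAddCommGroup Y] [InnerProductSpace 𝕜 Y] [CompleteSpace Y]
  (A : NormalOperator 𝕜 Y)

/-! ### The resolvent of `A* A` -/

/-- `1 + A* A` is surjective (von Neumann). -/
theorem exists_add_absSq_eq (y : Y) :
    ∃ (x : Y) (h : x ∈ A.absSq.domain), x + A.absSq ⟨x, h⟩ = y := by
  let e := WithLp.linearEquiv 2 𝕜 (Y × Y)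
  let G : Submodule 𝕜 (WithLp 2 (Y × Y)) := A.op.graph.comap e.toLinearMap
  have hG : IsClosed (G : Set (WithLp 2 (Y × Y))) :=
    A.closed.preimage (WithLp.prod_continuous_ofLp 2 Y Y)
  have : CompleteSpace G := hG.completeSpace_coe
  -- Write (y, 0) = (x, A x) + z with z orthogonal to the graph. Then z = (y - x, -A x), and
  -- orthogonality reads ⟨y - x, u⟩ = ⟨A x, A u⟩ for all u in D(A), that is, A* A x = y - x.
  obtain ⟨v, hv, z, hz, hvz⟩ := G.exists_add_mem_mem_orthogonal (WithLp.toLp 2 (y, 0))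
  have hv' : v.ofLp ∈ A.op.graph := hv
  obtain ⟨x, hx1, hx2⟩ := (LinearPMap.mem_graph_iff _).1 hv'
  have h1 : y = v.ofLp.1 + z.ofLp.1 := congrArg (fun w => w.ofLp.1) hvz
  have h2 : 0 = v.ofLp.2 + z.ofLp.2 := congrArg (fun w => w.ofLp.2) hvz
  have horth : ∀ u : A.op.domain, inner 𝕜 z.ofLp.1 u = inner 𝕜 (A.op x) (A.op u) := by
    intro u
    have h3 := (Submodule.mem_orthogonal' _ _).1 hz (WithLp.toLp 2 ((u : Y), A.op u))
      (A.op.mem_graph u)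
    rw [WithLp.prod_inner_apply] at h3
    have h4 : z.ofLp.2 = - A.op x := by rw [hx2]; exact (neg_eq_of_add_eq_zero_right h2.symm).symm
    simp only [h4, inner_neg_left] at h3
    exact add_neg_eq_zero.1 h3
  have hd : A.op x ∈ A.op†.domain := LinearPMap.mem_adjoint_domain_of_exists _ ⟨z.ofLp.1, horth⟩
  have hx : (x : Y) ∈ A.absSq.domain := A.mem_absSq.2 ⟨x.2, hd⟩
  refine ⟨x, hx, ?_⟩
  have h5 : A.absSq ⟨x, hx⟩ = z.ofLp.1 :=
    LinearPMap.adjoint_apply_eq A.dense ⟨A.op x, hd⟩ horth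
  rw [h5, hx1, h1]

theorem inner_add_absSq {x y : Y} (hx : x ∈ A.absSq.domain) (hxA : x ∈ A.op.domain)
    (hy : y ∈ A.op.domain) :
    inner 𝕜 (x + A.absSq ⟨x, hx⟩) y = inner 𝕜 x y + inner 𝕜 (A.op ⟨x, hxA⟩) (A.op ⟨y, hy⟩) := by
  rw [inner_add_left, A.inner_absSq hx hxA hy]

theorem re_inner_add_absSq_self {x : Y} (hx : x ∈ A.absSq.domain) (hxA : x ∈ A.op.domain) :
    RCLike.re (inner 𝕜 (x + A.absSq ⟨x, hx⟩) x) = ‖x‖ ^ 2 + ‖A.op ⟨x, hxA⟩‖ ^ 2 := by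
  rw [A.inner_add_absSq hx hxA hxA, map_add, inner_self_eq_norm_sq, inner_self_eq_norm_sq]

theorem norm_le_norm_add_absSq {x : Y} (hx : x ∈ A.absSq.domain) :
    ‖x‖ ≤ ‖x + A.absSq ⟨x, hx⟩‖ := by
  obtain ⟨hxA, _⟩ := A.mem_absSq.1 hx
  have h := A.re_inner_add_absSq_self hx hxA
  have h1 := re_inner_le_norm (𝕜 := 𝕜) (x + A.absSq ⟨x, hx⟩) x
  rcases (norm_nonneg x).eq_or_lt with h0 | h0
  · rw [← h0]; exact norm_nonneg _
  · nlinarith [sq_nonneg ‖A.op ⟨x, hxA⟩‖]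

/-- The bounded inverse `T` of `1 + A* A`. -/
theorem exists_resolvent : ∃ t : Y →L[𝕜] Y, ‖t‖ ≤ 1 ∧
    (∀ x, ∃ h : t x ∈ A.absSq.domain, t x + A.absSq ⟨t x, h⟩ = x) ∧
    ∀ x y, inner 𝕜 (t x) y = inner 𝕜 x (t y) := by
  choose f hf hfe using A.exists_add_absSq_eq
  have huniq : ∀ (x y : Y) (hy : y ∈ A.absSq.domain), y + A.absSq ⟨y, hy⟩ = x → f x = y := by
    intro x y hy hxy
    have hd : f x - y ∈ A.absSq.domain := Submodule.sub_mem _ (hf x) hy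
    have h0 : f x - y + A.absSq ⟨f x - y, hd⟩ = 0 := by
      have e : A.absSq ⟨f x - y, hd⟩ = A.absSq ⟨f x, hf x⟩ - A.absSq ⟨y, hy⟩ :=
        LinearPMap.map_sub _ ⟨f x, hf x⟩ ⟨y, hy⟩
      rw [e, sub_add_sub_comm, hfe, hxy, sub_self]
    have h1 := A.norm_le_norm_add_absSq hd
    rw [h0, norm_zero] at h1
    exact sub_eq_zero.1 (norm_le_zero_iff.1 h1)
  let l : Y →ₗ[𝕜] Y :=
    { toFun := f
      map_add' := fun x y => huniq _ _ (Submodule.add_mem _ (hf x) (hf y)) (by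
        have e : A.absSq ⟨f x + f y, Submodule.add_mem _ (hf x) (hf y)⟩
            = A.absSq ⟨f x, hf x⟩ + A.absSq ⟨f y, hf y⟩ :=
          LinearPMap.map_add _ ⟨f x, hf x⟩ ⟨f y, hf y⟩
        rw [e, add_add_add_comm, hfe, hfe])
      map_smul' := fun c x => huniq _ _ (Submodule.smul_mem _ c (hf x)) (by
        have e : A.absSq ⟨c • f x, Submodule.smul_mem _ c (hf x)⟩ = c • A.absSq ⟨f x, hf x⟩ :=
          LinearPMap.map_smul _ c ⟨f x, hf x⟩
        show c • f x + A.absSq ⟨c • f x, Submodule.smul_mem _ c (hf x)⟩ = c • x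
        rw [e, ← smul_add, hfe]) }
  have hl : ∀ x, ‖l x‖ ≤ 1 * ‖x‖ := fun x => by
    have := A.norm_le_norm_add_absSq (hf x)
    rw [hfe] at this
    rw [one_mul]; exact this
  refine ⟨l.mkContinuous 1 hl, l.mkContinuous_norm_le zero_le_one hl, fun x => ⟨hf x, hfe x⟩, ?_⟩
  intro x y
  show inner 𝕜 (f x) y = inner 𝕜 x (f y)
  calc inner 𝕜 (f x) y = inner 𝕜 (f x) (f y + A.absSq ⟨f y, hf y⟩) := by rw [hfe]
    _ = inner 𝕜 (f x + A.absSq ⟨f x, hf x⟩) (f y) := by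
      rw [inner_add_left, inner_add_right, A.absSq_symm (hf x) (hf y)]
    _ = inner 𝕜 x (f y) := by rw [hfe]

/-! ### The spectral gap -/

/-- A subspace on which the form of the resolvent is at least `1 / (1 + r ^ 2)` belongs to the
spectral subspace. -/
theorem le_specSubspace_of_resolvent {t : Y →L[𝕜] Y}
    (ht : ∀ x, ∃ h : t x ∈ A.absSq.domain, t x + A.absSq ⟨t x, h⟩ = x)
    (hsymm : ∀ x y, inner 𝕜 (t x) y = inner 𝕜 x (t y)) {r : ℝ} (hr : 1 ≤ r) {W : Submodule 𝕜 Y}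
    (hWc : IsClosed (W : Set Y)) (hWt : ∀ x ∈ W, t x ∈ W)
    (hW : ∀ x ∈ W, (1 + r ^ 2)⁻¹ * ‖x‖ ^ 2 ≤ RCLike.re (inner 𝕜 (t x) x)) :
    W ≤ A.specSubspace r := by
  set τ := (1 + r ^ 2)⁻¹ with hτ
  have hτ0 : 0 < τ := by positivity
  have hτr : τ * (1 + r ^ 2) = 1 := inv_mul_cancel₀ (by positivity)
  have : CompleteSpace W := hWc.completeSpace_coe
  -- the resolvent maps `W` onto `W`
  have hsurj : ∀ x ∈ W, ∃ z ∈ W, t z = x := by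
    let s : W →L[𝕜] W := (t.comp W.subtypeL).codRestrict W fun x => hWt x x.2
    have hτ1 : τ ≤ 1 := by nlinarith
    -- From ‖t z‖ ^ 2 ≤ ⟨t z, z⟩ and τ ‖z‖ ^ 2 ≤ ⟨t z, z⟩ one gets ‖z - t z‖ ^ 2 ≤ (1 - τ) ‖z‖ ^ 2,
    -- so the Neumann series inverts t on W.
    have hn : ‖1 - s‖ < 1 := by
      have hlt : √(1 - τ) < 1 := by
        rw [Real.sqrt_lt' one_pos]
        linarith
      refine lt_of_le_of_lt (ContinuousLinearMap.opNorm_le_bound _ (Real.sqrt_nonneg _) ?_) hlt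
      intro z
      refine (sq_le_sq₀ (norm_nonneg _) (by positivity)).1 ?_
      rw [mul_pow, Real.sq_sqrt (by linarith)]
      have e : ‖(1 - s) z‖ = ‖(z : Y) - t z‖ := rfl
      obtain ⟨h, he⟩ := ht z
      obtain ⟨hA, _⟩ := A.mem_absSq.1 h
      have h3 := A.re_inner_add_absSq_self h hA
      rw [he, ← hsymm] at h3
      have h4 := hW z z.2
      have h5 : ‖(z : Y)‖ = ‖z‖ := rfl
      rw [e, norm_sub_sq (𝕜 := 𝕜), ← hsymm, h5]
      rw [h5] at h4
      nlinarith [sq_nonneg ‖A.op ⟨t z, hA⟩‖]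
    obtain ⟨v, hv⟩ : IsUnit s := by
      have := isUnit_one_sub_of_norm_lt_one hn
      rwa [sub_sub_cancel] at this
    intro x hx
    refine ⟨(↑v⁻¹ : W →L[𝕜] W) ⟨x, hx⟩, Subtype.property _, ?_⟩
    have h1 : s * (↑v⁻¹ : W →L[𝕜] W) = 1 := by rw [← hv]; exact v.mul_inv
    exact congrArg (fun f : W →L[𝕜] W => (f ⟨x, hx⟩ : Y)) h1
  have hstep : ∀ x ∈ W, ∃ h : x ∈ A.absSq.domain,
      A.absSq ⟨x, h⟩ ∈ W ∧ ‖A.absSq ⟨x, h⟩‖ ≤ r ^ 2 * ‖x‖ := by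
    intro x hx
    obtain ⟨z, hz, rfl⟩ := hsurj x hx
    obtain ⟨h, he⟩ := ht z
    have he' : A.absSq ⟨t z, h⟩ = z - t z := eq_sub_of_add_eq' he
    refine ⟨h, ?_, ?_⟩
    · rw [he']; exact W.sub_mem hz hx
    · rw [he']
      refine (sq_le_sq₀ (norm_nonneg _) (by positivity)).1 ?_
      rw [norm_sub_sq (𝕜 := 𝕜), mul_pow, ← hsymm]
      have h1 := hW z hz
      -- `‖(t - τ) z‖ ^ 2 ≥ 0`
      have h2 : 0 ≤ ‖t z‖ ^ 2 - 2 * τ * RCLike.re (inner 𝕜 (t z) z) + τ ^ 2 * ‖z‖ ^ 2 := by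
        have h3 : ‖t z - (τ : 𝕜) • z‖ ^ 2
            = ‖t z‖ ^ 2 - 2 * τ * RCLike.re (inner 𝕜 (t z) z) + τ ^ 2 * ‖z‖ ^ 2 := by
          rw [norm_sub_sq (𝕜 := 𝕜), inner_smul_right, norm_smul, RCLike.norm_ofReal,
            RCLike.re_ofReal_mul, abs_of_pos hτ0]
          ring
        rw [← h3]; positivity
      set p := RCLike.re (inner 𝕜 (t z) z)
      have hr2 : r ^ 2 = τ⁻¹ - 1 := by rw [hτ, inv_inv]; ring
      have hτ1 : 2 * τ ≤ 1 := by nlinarith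
      rw [hr2]
      -- The right-hand side equals (1 - 2 τ) ‖(t - τ) z‖ ^ 2 + 2 τ (1 - τ) (p - τ ‖z‖ ^ 2). The
      -- assumption 1 ≤ r enters through 2 τ ≤ 1.
      have key : 0 ≤ (1 - 2 * τ) * ‖t z‖ ^ 2 - τ ^ 2 * ‖z‖ ^ 2 + 2 * τ ^ 2 * p := by
        nlinarith [mul_nonneg (sub_nonneg.2 hτ1) h2,
          mul_nonneg (mul_nonneg hτ0.le (by linarith : 0 ≤ 1 - τ)) (sub_nonneg.2 h1)]
      have e : (τ⁻¹ - 1) ^ 2 * ‖t z‖ ^ 2 - (‖z‖ ^ 2 - 2 * p + ‖t z‖ ^ 2)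
          = τ⁻¹ ^ 2 * ((1 - 2 * τ) * ‖t z‖ ^ 2 - τ ^ 2 * ‖z‖ ^ 2 + 2 * τ ^ 2 * p) := by
        field_simp
        ring
      have : 0 ≤ τ⁻¹ ^ 2 * ((1 - 2 * τ) * ‖t z‖ ^ 2 - τ ^ 2 * ‖z‖ ^ 2 + 2 * τ ^ 2 * p) := by
        positivity
      linarith
  refine fun x hx => ⟨‖x‖, fun n => ?_⟩
  induction n generalizing x with
  | zero => exact ⟨mem_ppow_zero _ _, by rw [ppow_zero_apply]; simp⟩
  | succ n ih =>
    obtain ⟨h, hW', hn⟩ := hstep x hx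
    obtain ⟨h', hn'⟩ := ih _ hW'
    refine ⟨mem_ppow_succ.2 ⟨h, h'⟩, ?_⟩
    calc ‖ppow A.absSq (n + 1) ⟨x, mem_ppow_succ.2 ⟨h, h'⟩⟩‖
        = ‖ppow A.absSq n ⟨A.absSq ⟨x, h⟩, h'⟩‖ := rfl
      _ ≤ ‖A.absSq ⟨x, h⟩‖ * r ^ (2 * n) := hn'
      _ ≤ r ^ 2 * ‖x‖ * r ^ (2 * n) := by gcongr
      _ = _ := by ring

/-- On the orthogonal complement of the spectral subspace of the disc of radius `r`, the operator
is bounded below by `r`. -/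
theorem le_norm_op_of_orthogonal {r : ℝ} (hr : 1 ≤ r) {x : Y} (hx : x ∈ A.op.domain)
    (hxo : x ∈ (A.specSubspace r).topologicalClosureᗮ) : r * ‖x‖ ≤ ‖A.op ⟨x, hx⟩‖ := by
  obtain ⟨t, htn, ht, hsymm⟩ := A.exists_resolvent
  set τ := (1 + r ^ 2)⁻¹ with hτ
  have hτ0 : 0 < τ := by positivity
  have hτr : τ * (1 + r ^ 2) = 1 := inv_mul_cancel₀ (by positivity)
  have hτ1 : τ ≤ 1 := by nlinarith
  -- The factor 1/2 only normalizes to ‖g‖ ≤ 1; the sign of g is that of t - τ.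
  let g : Y →L[𝕜] Y := (2⁻¹ : 𝕜) • (t - (τ : 𝕜) • 1)
  have hgapp : ∀ x, g x = (2⁻¹ : 𝕜) • (t x - (τ : 𝕜) • x) := fun x => rfl
  have hg : ∀ x y, inner 𝕜 (g x) y = inner 𝕜 x (g y) := by
    intro x y
    simp only [hgapp, inner_smul_left, inner_smul_right, inner_sub_left, inner_sub_right, hsymm,
      map_inv₀, map_ofNat, RCLike.conj_ofReal]
  have hgn : ‖g‖ ≤ 1 := by
    have h1 : ‖t - (τ : 𝕜) • (1 : Y →L[𝕜] Y)‖ ≤ 1 + 1 := by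
      refine (norm_sub_le _ _).trans (add_le_add htn ?_)
      rw [norm_smul, RCLike.norm_ofReal, abs_of_pos hτ0]
      exact mul_le_one₀ hτ1 (norm_nonneg _) ContinuousLinearMap.norm_id_le
    calc ‖g‖ = 2⁻¹ * ‖t - (τ : 𝕜) • (1 : Y →L[𝕜] Y)‖ := by
          rw [norm_smul, norm_inv, RCLike.norm_two]
      _ ≤ _ := by linarith
  have hgre : ∀ x, RCLike.re (inner 𝕜 (g x) x)
      = 2⁻¹ * (RCLike.re (inner 𝕜 (t x) x) - τ * ‖x‖ ^ 2) := by
    intro x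
    have e : (2⁻¹ : 𝕜) = ((2⁻¹ : ℝ) : 𝕜) := by push_cast; rfl
    rw [hgapp, e, inner_smul_left, RCLike.conj_ofReal, RCLike.re_ofReal_mul, inner_sub_left,
      map_sub, inner_smul_left, RCLike.conj_ofReal, RCLike.re_ofReal_mul, inner_self_eq_norm_sq]
  have hcomm : Commute g t := by
    refine Commute.smul_left (Commute.sub_left (Commute.refl t) ?_) _
    exact (Commute.one_left t).smul_left _
  obtain ⟨W, hWc, hWi, hWp, hWn⟩ := exists_sign_splitting hg hgn
  have hW : W ≤ A.specSubspace r := by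
    refine A.le_specSubspace_of_resolvent ht hsymm hr hWc (hWi t hcomm) fun z hz => ?_
    have := hWp z hz
    rw [hgre] at this
    linarith
  have hxW : x ∈ Wᗮ :=
    Submodule.orthogonal_le (hW.trans (Submodule.le_topologicalClosure _)) hxo
  have h1 : RCLike.re (inner 𝕜 (t x) x) ≤ τ * ‖x‖ ^ 2 := by
    have := hWn x hxW
    rw [hgre] at this
    linarith
  obtain ⟨hq, hqe⟩ := ht x
  obtain ⟨hqA, _⟩ := A.mem_absSq.1 hq
  -- In the graph scalar product, t x paired with x gives ‖x‖ ^ 2, whereas the squared graph norm of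
  -- t x is ⟨t x, x⟩ ≤ τ ‖x‖ ^ 2.
  have h2 : ‖x‖ ^ 2 = RCLike.re (inner 𝕜 (t x) x)
      + RCLike.re (inner 𝕜 (A.op ⟨t x, hqA⟩) (A.op ⟨x, hx⟩)) := by
    rw [← inner_self_eq_norm_sq (𝕜 := 𝕜), ← map_add, ← A.inner_add_absSq hq hqA hx, hqe]
  have h3 : RCLike.re (inner 𝕜 (t x) x) = ‖t x‖ ^ 2 + ‖A.op ⟨t x, hqA⟩‖ ^ 2 := by
    rw [← A.re_inner_add_absSq_self hq hqA, hqe, hsymm]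
  set q := t x with hqdef
  -- Cauchy–Schwarz in the graph norm, in the form `2 ⟨a, b⟩ ≤ s ‖a‖ ^ 2 + s⁻¹ ‖b‖ ^ 2`
  set s := 1 + r ^ 2 with hs
  have hs0 : 0 < s := by positivity
  have h4 := re_inner_le_norm (𝕜 := 𝕜) q x
  have h5 := re_inner_le_norm (𝕜 := 𝕜) (A.op ⟨q, hqA⟩) (A.op ⟨x, hx⟩)
  have h6 : s * (‖q‖ ^ 2 + ‖A.op ⟨q, hqA⟩‖ ^ 2) ≤ ‖x‖ ^ 2 := by
    rw [← h3]
    calc s * _ ≤ s * (τ * ‖x‖ ^ 2) := by gcongr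
      _ = _ := by rw [← mul_assoc, mul_comm s, hτr, one_mul]
  have h7 : s * ‖x‖ ^ 2 ≤ ‖x‖ ^ 2 + ‖A.op ⟨x, hx⟩‖ ^ 2 := by
    nlinarith [sq_nonneg (s * ‖q‖ - ‖x‖), sq_nonneg (s * ‖A.op ⟨q, hqA⟩‖ - ‖A.op ⟨x, hx⟩‖)]
  refine (sq_le_sq₀ (by positivity) (norm_nonneg _)).1 ?_
  rw [mul_pow]
  nlinarith

end Galerkin.NormalOperator

namespace Galerkin

/-! ### Powers of a partially defined operator -/

section PowCommute

variable {𝕜 E : Type*} [RCLike 𝕜] [NormedAddCommGroup E] [InnerProductSpace 𝕜 E]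

theorem pmap_congr (f : E →ₗ.[𝕜] E) {x y : E} (hx : x ∈ f.domain) (hy : y ∈ f.domain)
    (h : x = y) : f ⟨x, hx⟩ = f ⟨y, hy⟩ := by
  subst h; rfl

/-- `f ^ (n + 1) = f f ^ n`. -/
theorem ppow_succ_apply' (f : E →ₗ.[𝕜] E) (n : ℕ) : ∀ {x : E} (hx : x ∈ (ppow f (n + 1)).domain)
    (hn : x ∈ (ppow f n).domain),
    ∃ h : ppow f n ⟨x, hn⟩ ∈ f.domain, ppow f (n + 1) ⟨x, hx⟩ = f ⟨ppow f n ⟨x, hn⟩, h⟩ := by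
  induction n with
  | zero => intro x hx _; exact ⟨(mem_ppow_succ.1 hx).1, rfl⟩
  | succ n ih =>
    intro x hx hn
    obtain ⟨_, h2⟩ := mem_ppow_succ.1 hx
    exact ih h2 (mem_ppow_succ.1 hn).2

end PowCommute

namespace NormalOperator

variable {𝕜 Y : Type*} [RCLike 𝕜] [NormedAddCommGroup Y] [InnerProductSpace 𝕜 Y] [CompleteSpace Y]
  (A : NormalOperator 𝕜 Y)

/-! ### The spectral projectors commute with `A` -/

/-- The range of the spectral projector onto the disc of radius `r`. -/
abbrev discSpace (r : ℝ) : Submodule 𝕜 Y := (A.specSubspace r).topologicalClosure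

theorem adjoint_comm_absSq {x : Y} (hx : x ∈ A.absSq.domain) (hA : x ∈ A.op†.domain)
    (hHx : A.absSq ⟨x, hx⟩ ∈ A.op†.domain) :
    ∃ h : A.op† ⟨x, hA⟩ ∈ A.absSq.domain,
      A.absSq ⟨A.op† ⟨x, hA⟩, h⟩ = A.op† ⟨A.absSq ⟨x, hx⟩, hHx⟩ := by
  obtain ⟨_, h2, h3⟩ := A.normal_apply hx
  have h4 : A.op ⟨A.op† ⟨x, hA⟩, h2⟩ ∈ A.op†.domain := by rw [h3]; exact hHx
  exact ⟨A.mem_absSq.2 ⟨h2, h4⟩, pmap_congr _ h4 hHx h3⟩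

theorem ppow_absSq_adjoint_comm (n : ℕ) : ∀ {x : Y} (_ : x ∈ (ppow A.absSq (n + 1)).domain)
    (hA : x ∈ A.op†.domain) (hn : x ∈ (ppow A.absSq n).domain),
    ∃ (h : A.op† ⟨x, hA⟩ ∈ (ppow A.absSq n).domain)
      (h' : ppow A.absSq n ⟨x, hn⟩ ∈ A.op†.domain),
      ppow A.absSq n ⟨A.op† ⟨x, hA⟩, h⟩ = A.op† ⟨ppow A.absSq n ⟨x, hn⟩, h'⟩ := by
  induction n with
  | zero => intro x _ hA _; exact ⟨trivial, hA, rfl⟩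
  | succ n ih =>
    intro x hx hA hn
    obtain ⟨h1, h2⟩ := mem_ppow_succ.1 hx
    obtain ⟨_, h3⟩ := mem_ppow_succ.1 hn
    have hHA : A.absSq ⟨x, h1⟩ ∈ A.op†.domain := (A.normal_apply (mem_ppow_succ.1 h2).1).1
    obtain ⟨h4, h5⟩ := A.adjoint_comm_absSq h1 hA hHA
    obtain ⟨h6, h7, h8⟩ := ih h2 hHA h3
    have h6' : A.absSq ⟨A.op† ⟨x, hA⟩, h4⟩ ∈ (ppow A.absSq n).domain := by rw [h5]; exact h6
    exact ⟨mem_ppow_succ.2 ⟨h4, h6'⟩, h7, (pmap_congr _ h6' h6 h5).trans h8⟩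

theorem ppow_absSq_mem_specSubspace {r : ℝ} (n : ℕ) : ∀ {x : Y} (_ : x ∈ A.specSubspace r)
    (hn : x ∈ (ppow A.absSq n).domain), ppow A.absSq n ⟨x, hn⟩ ∈ A.specSubspace r := by
  induction n with
  | zero => intro x hx _; exact hx
  | succ n ih =>
    intro x hx hn
    exact ih (A.absSq_mem_specSubspace hx).2 (mem_ppow_succ.1 hn).2

/-- By normality A* commutes with A* A, and ‖A* y‖ ^ 2 = ⟨y, A A* y⟩ = ⟨y, A* A y⟩ ≤ r ^ 2 ‖y‖ ^ 2
on the spectral subspace. By duality, A then preserves the orthogonal complement. -/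
theorem adjoint_mem_specSubspace {r : ℝ} {x : Y} (hx : x ∈ A.specSubspace r) :
    ∃ h : x ∈ A.op†.domain, A.op† ⟨x, h⟩ ∈ A.specSubspace r := by
  have bound : ∀ y ∈ A.specSubspace r, ∀ h : y ∈ A.op†.domain,
      ‖A.op† ⟨y, h⟩‖ ≤ |r| * ‖y‖ := by
    intro y hy h
    obtain ⟨hH, _⟩ := A.absSq_mem_specSubspace hy
    obtain ⟨_, h2, h3⟩ := A.normal_apply hH
    have h1 : ‖A.op† ⟨y, h⟩‖ ^ 2 ≤ (|r| * ‖y‖) ^ 2 := by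
      have e := LinearPMap.adjoint_isFormalAdjoint A.dense ⟨y, h⟩ ⟨_, h2⟩
      rw [h3] at e
      rw [← inner_self_eq_norm_sq (𝕜 := 𝕜), e, mul_pow, sq_abs]
      calc _ ≤ ‖y‖ * ‖A.absSq ⟨y, hH⟩‖ := re_inner_le_norm _ _
        _ ≤ ‖y‖ * (r ^ 2 * ‖y‖) :=
          mul_le_mul_of_nonneg_left (A.norm_absSq_le hy hH) (norm_nonneg _)
        _ = _ := by ring
    exact (sq_le_sq₀ (norm_nonneg _) (by positivity)).1 h1
  obtain ⟨hH, _⟩ := A.absSq_mem_specSubspace hx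
  obtain ⟨hA, _⟩ := A.normal_apply hH
  obtain ⟨C, hC⟩ := id hx
  refine ⟨hA, |r| * C, fun n => ?_⟩
  obtain ⟨h1, h2⟩ := hC n
  obtain ⟨h3, h4, h5⟩ := A.ppow_absSq_adjoint_comm n (hC (n + 1)).1 hA h1
  refine ⟨h3, ?_⟩
  rw [h5, mul_assoc]
  exact (bound _ (A.ppow_absSq_mem_specSubspace n hx h1) h4).trans
    (mul_le_mul_of_nonneg_left h2 (abs_nonneg r))

theorem op_mem_orthogonal {r : ℝ} {x : Y} (hx : x ∈ A.op.domain) (hxo : x ∈ (A.discSpace r)ᗮ) :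
    A.op ⟨x, hx⟩ ∈ (A.discSpace r)ᗮ := by
  rw [Submodule.orthogonal_closure, Submodule.mem_orthogonal] at hxo ⊢
  intro y hy
  obtain ⟨h, hy'⟩ := A.adjoint_mem_specSubspace hy
  have e := LinearPMap.adjoint_isFormalAdjoint A.dense ⟨y, h⟩ ⟨x, hx⟩
  exact e.symm.trans (hxo _ hy')

theorem specProj_mem_discSpace (r : ℝ) (x : Y) : A.specProj r x ∈ A.discSpace r :=
  Submodule.starProjection_apply_mem _ x

theorem sub_specProj_mem (r : ℝ) (x : Y) : x - A.specProj r x ∈ (A.discSpace r)ᗮ :=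
  Submodule.sub_starProjection_mem_orthogonal x

theorem specProj_eq_self {r : ℝ} {x : Y} (hx : x ∈ A.discSpace r) : A.specProj r x = x :=
  Submodule.starProjection_eq_self_iff.2 hx

theorem specProj_eq_zero {r : ℝ} {x : Y} (hx : x ∈ (A.discSpace r)ᗮ) : A.specProj r x = 0 :=
  Submodule.eq_starProjection_of_mem_orthogonal (Submodule.zero_mem _) (by rwa [sub_zero])

theorem norm_specProj_le (r : ℝ) (x : Y) : ‖A.specProj r x‖ ≤ ‖x‖ :=
  Submodule.norm_starProjection_apply_le _ x

theorem norm_sq_eq_specProj (r : ℝ) (x : Y) :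
    ‖x‖ ^ 2 = ‖A.specProj r x‖ ^ 2 + ‖x - A.specProj r x‖ ^ 2 := by
  have h : inner 𝕜 (A.specProj r x) (x - A.specProj r x) = 0 :=
    (Submodule.mem_orthogonal _ _).1 (A.sub_specProj_mem r x) _ (A.specProj_mem_discSpace r x)
  have h2 := norm_add_sq_eq_norm_sq_add_norm_sq_of_inner_eq_zero _ _ h
  rw [add_sub_cancel] at h2
  simpa only [pow_two] using h2

theorem norm_sub_specProj_le (r : ℝ) (x : Y) : ‖x - A.specProj r x‖ ≤ ‖x‖ := by
  refine (sq_le_sq₀ (norm_nonneg _) (norm_nonneg _)).1 ?_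
  nlinarith [A.norm_sq_eq_specProj r x, sq_nonneg ‖A.specProj r x‖]

/-- Both the disc space and its orthogonal complement are invariant under A, so A maps the
orthogonal decomposition of x to that of A x. -/
theorem op_specProj (r : ℝ) {x : Y} (hx : x ∈ A.op.domain) :
    ∃ h : A.specProj r x ∈ A.op.domain, A.op ⟨A.specProj r x, h⟩ = A.specProj r (A.op ⟨x, hx⟩) := by
  obtain ⟨h, h'⟩ := A.op_mem_closure (A.specProj_mem_discSpace r x)
  refine ⟨h, (Submodule.eq_starProjection_of_mem_orthogonal h' ?_).symm⟩
  rw [← LinearPMap.map_sub]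
  exact A.op_mem_orthogonal (Submodule.sub_mem _ hx h) (A.sub_specProj_mem r x)

theorem ppow_specProj (r : ℝ) (n : ℕ) : ∀ {x : Y} (hx : x ∈ (ppow A.op n).domain),
    ppow A.op n ⟨A.specProj r x, A.specProj_mem r n x⟩ = A.specProj r (ppow A.op n ⟨x, hx⟩) := by
  induction n with
  | zero => intro x _; rfl
  | succ n ih =>
    intro x hx
    obtain ⟨h1, h2⟩ := mem_ppow_succ.1 hx
    obtain ⟨h3, h4⟩ := A.op_specProj r h1
    rw [show ppow A.op (n + 1) ⟨x, hx⟩ = ppow A.op n ⟨A.op ⟨x, h1⟩, h2⟩ from rfl, ← ih h2]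
    exact pmap_congr _ (mem_ppow_succ.1 (A.specProj_mem r (n + 1) x)).2 _ h4

theorem ppow_mem_orthogonal {r : ℝ} (n : ℕ) {x : Y} (hx : x ∈ (ppow A.op n).domain)
    (hxo : x ∈ (A.discSpace r)ᗮ) : ppow A.op n ⟨x, hx⟩ ∈ (A.discSpace r)ᗮ := by
  induction n generalizing x with
  | zero => exact hxo
  | succ n ih =>
    obtain ⟨h1, h2⟩ := mem_ppow_succ.1 hx
    exact ih h2 (A.op_mem_orthogonal h1 hxo)

/-- Iterating the lower bound for A is possible because the complement is invariant. Each order of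
regularity gains a factor r; this is the source of the powers of m. -/
theorem pow_mul_norm_ppow_le {r : ℝ} (hr : 1 ≤ r) {x : Y} (hxo : x ∈ (A.discSpace r)ᗮ) (j d : ℕ)
    (hj : x ∈ (ppow A.op j).domain) (hd : x ∈ (ppow A.op (j + d)).domain) :
    r ^ d * ‖ppow A.op j ⟨x, hj⟩‖ ≤ ‖ppow A.op (j + d) ⟨x, hd⟩‖ := by
  induction d with
  | zero => simp
  | succ d ih =>
    have hd' := ppow_domain_succ_le A.op (j + d) hd
    obtain ⟨h, e⟩ := ppow_succ_apply' A.op (j + d) hd hd'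
    calc r ^ (d + 1) * ‖ppow A.op j ⟨x, hj⟩‖ = r * (r ^ d * ‖ppow A.op j ⟨x, hj⟩‖) := by ring
      _ ≤ r * ‖ppow A.op (j + d) ⟨x, hd'⟩‖ := by gcongr; exact ih hd'
      _ ≤ ‖A.op ⟨_, h⟩‖ := A.le_norm_op_of_orthogonal hr h (A.ppow_mem_orthogonal _ hd' hxo)
      _ = _ := by rw [← e]; rfl

theorem specSubspace_mono {r s : ℝ} (hr : 0 ≤ r) (hrs : r ≤ s) :
    A.specSubspace r ≤ A.specSubspace s := by
  rintro x ⟨C, hC⟩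
  refine ⟨|C|, fun n => ?_⟩
  obtain ⟨h, hn⟩ := hC n
  refine ⟨h, hn.trans ?_⟩
  gcongr
  exact le_abs_self C

theorem discSpace_mono {r s : ℝ} (hr : 0 ≤ r) (hrs : r ≤ s) : A.discSpace r ≤ A.discSpace s :=
  Submodule.topologicalClosure_mono (A.specSubspace_mono hr hrs)

theorem specProj_specProj {r s : ℝ} (hr : 0 ≤ r) (hrs : r ≤ s) (x : Y) :
    A.specProj r (A.specProj s x) = A.specProj r x := by
  have h : x - A.specProj s x ∈ (A.discSpace r)ᗮ :=
    Submodule.orthogonal_le (A.discSpace_mono hr hrs) (A.sub_specProj_mem s x)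
  have h2 := A.specProj_eq_zero h
  rw [map_sub, sub_eq_zero] at h2
  exact h2.symm

theorem specProj_specProj' {r s : ℝ} (hr : 0 ≤ r) (hrs : r ≤ s) (x : Y) :
    A.specProj s (A.specProj r x) = A.specProj r x :=
  A.specProj_eq_self (A.discSpace_mono hr hrs (A.specProj_mem_discSpace r x))

/-! ### Estimates on the scale -/

namespace Scale

variable {A} {l : ℕ}

theorem highPart_eq (x : A.Scale l) :
    highPart x = ppow A.op l ⟨val x - A.specProj 1 (val x), high_mem x⟩ := rfl

theorem val_incl {k : ℕ} (h : k ≤ l) (x : A.Scale l) : val (incl h x) = val x := rfl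

/-- The low parts agree, and the high parts are compared by the case r = 1 of
`pow_mul_norm_ppow_le`. -/
theorem norm_incl_le {k : ℕ} (h : k ≤ l) (x : A.Scale l) : ‖incl h x‖ ≤ ‖x‖ := by
  refine (sq_le_sq₀ (norm_nonneg _) (norm_nonneg _)).1 ?_
  obtain ⟨d, rfl⟩ := Nat.exists_eq_add_of_le h
  rw [norm_sq, norm_sq]
  have h1 := A.pow_mul_norm_ppow_le le_rfl (A.sub_specProj_mem 1 (val x)) k d
    (high_mem (incl h x)) (high_mem x)
  rw [one_pow, one_mul] at h1
  have h2 : ‖highPart (incl h x)‖ ≤ ‖highPart x‖ := h1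
  have h3 : lowPart (incl h x) = lowPart x := rfl
  rw [h3]
  gcongr

theorem norm_eq_norm_val (x : A.Scale 0) : ‖x‖ = ‖val x‖ := by
  refine (sq_eq_sq₀ (norm_nonneg _) (norm_nonneg _)).1 ?_
  rw [norm_sq, A.norm_sq_eq_specProj 1 (val x)]
  rfl

theorem norm_val_le (x : A.Scale l) : ‖val x‖ ≤ ‖x‖ := by
  rw [← val_incl l.zero_le x, ← norm_eq_norm_val]
  exact norm_incl_le _ x

variable (A l) in
/-- The inclusion of a scale space into `Y` as a bounded operator. -/
def valL : A.Scale l →L[𝕜] Y :=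
  val.mkContinuous 1 fun x => by rw [one_mul]; exact norm_val_le x

variable (A) in
/-- The inclusion between two scale spaces as a bounded operator. -/
def inclL {k : ℕ} (h : k ≤ l) : A.Scale l →L[𝕜] A.Scale k :=
  (incl h).mkContinuous 1 fun x => by rw [one_mul]; exact norm_incl_le h x

instance : IsScalarTower ℝ 𝕜 (A.Scale l) :=
  ⟨fun a b x => by
    show (a • b) • x = (a : 𝕜) • (b • x)
    rw [smul_smul, RCLike.real_smul_eq_coe_mul]⟩

end Scale

/-! ### The range of a spectral projector -/

/-- `A` restricts to a bounded operator on the range of a spectral projector. -/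
theorem exists_restrict (r : ℝ) : ∃ f : A.discSpace r →L[𝕜] A.discSpace r,
    ∀ x : A.discSpace r, ∃ h : (x : Y) ∈ A.op.domain, (f x : Y) = A.op ⟨x, h⟩ := by
  have hd : ∀ x : A.discSpace r, (x : Y) ∈ A.op.domain := fun x => (A.op_mem_closure x.2).1
  let f : A.discSpace r →ₗ[𝕜] A.discSpace r :=
    { toFun := fun x => ⟨A.op ⟨x, hd x⟩, (A.op_mem_closure x.2).2⟩
      map_add' := fun x y => Subtype.ext (LinearPMap.map_add A.op ⟨x, hd x⟩ ⟨y, hd y⟩)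
      map_smul' := fun c x => Subtype.ext (LinearPMap.map_smul A.op c ⟨x, hd x⟩) }
  have hf : IsClosed (f.graph : Set (A.discSpace r × A.discSpace r)) := by
    have e : (f.graph : Set (A.discSpace r × A.discSpace r))
        = (fun p => ((p.1 : Y), (p.2 : Y))) ⁻¹' (A.op.graph : Set (Y × Y)) := by
      ext ⟨x, y⟩
      simp only [SetLike.mem_coe, LinearMap.mem_graph_iff, mem_preimage]
      constructor
      · rintro rfl
        exact A.op.mem_graph ⟨x, hd x⟩
      · intro h
        obtain ⟨z, hz1, hz2⟩ := (LinearPMap.mem_graph_iff _).1 h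
        refine Subtype.ext (hz2.symm.trans ?_)
        exact pmap_congr _ z.2 (hd x) hz1
    rw [e]
    exact A.closed.preimage (by fun_prop)
  exact ⟨ContinuousLinearMap.ofIsClosedGraph hf, fun x => ⟨hd x, rfl⟩⟩

/-- The restriction of `A` to the range of a spectral projector. -/
def restrict (r : ℝ) : A.discSpace r →L[𝕜] A.discSpace r := (A.exists_restrict r).choose

theorem discSpace_le_domain (r : ℝ) {x : Y} (hx : x ∈ A.discSpace r) : x ∈ A.op.domain :=
  (A.op_mem_closure hx).1

theorem coe_restrict {r : ℝ} (x : A.discSpace r) :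
    (A.restrict r x : Y) = A.op ⟨x, A.discSpace_le_domain r x.2⟩ :=
  ((A.exists_restrict r).choose_spec x).2

theorem coe_restrict_pow {r : ℝ} (n : ℕ) (x : A.discSpace r) :
    (((A.restrict r) ^ n) x : Y) = ppow A.op n ⟨x, A.closure_le_domain r n x.2⟩ := by
  induction n generalizing x with
  | zero => rfl
  | succ n ih =>
    rw [pow_succ, mul_apply_eq_comp, ih]
    exact pmap_congr _ _ (mem_ppow_succ.1 (A.closure_le_domain r (n + 1) x.2)).2 (A.coe_restrict x)

-- The powers of A are bounded on the disc space. As 1 ≤ r, the projection onto the unit disc leaves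
-- this space invariant, so A ^ k may be applied to the high part within it.
open Scale in
theorem exists_toScale {r : ℝ} (hr : 1 ≤ r) (k : ℕ) :
    ∃ f : A.discSpace r →L[𝕜] A.Scale k, ∀ x, val (f x) = x := by
  let f : A.discSpace r →ₗ[𝕜] A.Scale k :=
    { toFun := fun x => Scale.mk (x : Y) (A.closure_le_domain r k x.2)
      map_add' := fun x y => rfl
      map_smul' := fun c x => rfl }
  refine ⟨f.mkContinuous (1 + ‖(A.restrict r) ^ k‖) fun x => ?_, fun x => rfl⟩
  refine (sq_le_sq₀ (norm_nonneg _) (by positivity)).1 ?_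
  rw [norm_sq]
  have h1 : ‖lowPart (f x)‖ ≤ ‖x‖ := A.norm_specProj_le 1 (x : Y)
  have hmem : (x : Y) - A.specProj 1 (x : Y) ∈ A.discSpace r :=
    Submodule.sub_mem _ x.2 (A.discSpace_mono zero_le_one hr (A.specProj_mem_discSpace 1 _))
  have h2 : ‖highPart (f x)‖ ≤ ‖(A.restrict r) ^ k‖ * ‖x‖ := by
    have e : highPart (f x) = (((A.restrict r) ^ k) ⟨_, hmem⟩ : Y) :=
      (A.coe_restrict_pow k ⟨_, hmem⟩).symm
    rw [e]
    refine (((A.restrict r) ^ k).le_opNorm ⟨_, hmem⟩).trans ?_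
    gcongr
    exact A.norm_sub_specProj_le 1 (x : Y)
  have h3 : 0 ≤ ‖lowPart (f x)‖ := norm_nonneg _
  have h4 : 0 ≤ ‖highPart (f x)‖ := norm_nonneg _
  nlinarith

/-- The inclusion of the range of a spectral projector into a space of the scale. -/
def toScale {r : ℝ} (hr : 1 ≤ r) (k : ℕ) : A.discSpace r →L[𝕜] A.Scale k :=
  (A.exists_toScale hr k).choose

/-! ### Spectral truncation and dissipativity on the scale -/

section toScale

open Scale

variable {r : ℝ} (hr : 1 ≤ r) (k : ℕ)

theorem val_toScale (x : A.discSpace r) : val (A.toScale hr k x) = x :=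
  (A.exists_toScale hr k).choose_spec x

theorem incl_toScale {j : ℕ} (h : j ≤ k) (x : A.discSpace r) :
    incl h (A.toScale hr k x) = A.toScale hr j x :=
  val_injective (by rw [val_incl, val_toScale, val_toScale])

theorem norm_toScale_zero (x : A.discSpace r) : ‖A.toScale hr 0 x‖ = ‖x‖ := by
  rw [norm_eq_norm_val, val_toScale]; rfl

theorem norm_le_norm_toScale (x : A.discSpace r) : ‖x‖ ≤ ‖A.toScale hr k x‖ := by
  rw [← A.norm_toScale_zero hr, ← A.incl_toScale hr k k.zero_le]
  exact norm_incl_le _ _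

/-- The spectral projector as a map onto its range. -/
def toDisc (r : ℝ) : Y →L[𝕜] A.discSpace r :=
  (A.specProj r).codRestrict _ (A.specProj_mem_discSpace r)

theorem coe_toDisc (x : Y) : (A.toDisc r x : Y) = A.specProj r x := rfl

theorem highPart_toScale_toDisc (x : A.Scale k) :
    highPart (A.toScale hr k (A.toDisc r (val x))) = A.specProj r (highPart x) := by
  rw [highPart_eq, highPart_eq, ← A.ppow_specProj r k (high_mem x)]
  refine pmap_congr _ _ _ ?_
  rw [val_toScale, coe_toDisc, map_sub, A.specProj_specProj zero_le_one hr,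
    A.specProj_specProj' zero_le_one hr]

theorem lowPart_toScale_toDisc (x : A.Scale k) :
    lowPart (A.toScale hr k (A.toDisc r (val x))) = lowPart x := by
  show A.specProj 1 (val (A.toScale hr k (A.toDisc r (val x)))) = A.specProj 1 (val x)
  rw [val_toScale, coe_toDisc, A.specProj_specProj zero_le_one hr]

/-- The truncation leaves the low part unchanged, since 1 ≤ r, and acts on the high part as an
orthogonal projection. -/
theorem norm_toScale_toDisc_le (x : A.Scale k) :
    ‖A.toScale hr k (A.toDisc r (val x))‖ ≤ ‖x‖ := by
  refine (sq_le_sq₀ (norm_nonneg _) (norm_nonneg _)).1 ?_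
  rw [norm_sq, norm_sq, lowPart_toScale_toDisc, highPart_toScale_toDisc]
  gcongr
  exact A.norm_specProj_le _ _

/-- The truncation error of the spectral projector on the scale. -/
theorem pow_mul_norm_incl_sub_toScale_le (j d : ℕ) (x : A.Scale (j + d)) :
    r ^ d * ‖incl (j.le_add_right d) x - A.toScale hr j (A.toDisc r (val x))‖ ≤ ‖x‖ := by
  -- The truncation error has no low part, so its norms are those of powers of A on the complement
  -- of the disc space.
  set z := x - A.toScale hr (j + d) (A.toDisc r (val x)) with hz
  have e0 : incl (j.le_add_right d) x - A.toScale hr j (A.toDisc r (val x))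
      = incl (j.le_add_right d) z := by
    rw [hz, map_sub, incl_toScale]
  rw [e0]
  have hval : val z = val x - A.specProj r (val x) := by rw [hz, map_sub, val_toScale]; rfl
  have hlow : lowPart z = 0 := by rw [hz, map_sub, lowPart_toScale_toDisc, sub_self]
  have horth : val z - A.specProj 1 (val z) ∈ (A.discSpace r)ᗮ := by
    have e : A.specProj 1 (val z) = 0 := hlow
    rw [e, sub_zero, hval]
    exact A.sub_specProj_mem r _
  have h1 : r ^ d * ‖highPart (incl (j.le_add_right d) z)‖ ≤ ‖highPart z‖ :=
    A.pow_mul_norm_ppow_le hr horth j d (high_mem (incl (j.le_add_right d) z)) (high_mem z)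
  have h2 : ‖highPart z‖ ≤ ‖highPart x‖ := by
    rw [hz, map_sub, highPart_toScale_toDisc]
    exact A.norm_sub_specProj_le r _
  have h3 : ‖incl (j.le_add_right d) z‖ = ‖highPart (incl (j.le_add_right d) z)‖ := by
    refine (sq_eq_sq₀ (norm_nonneg _) (norm_nonneg _)).1 ?_
    have e : lowPart (incl (j.le_add_right d) z) = 0 := hlow
    rw [norm_sq, e]
    simp
  have h4 : ‖highPart x‖ ≤ ‖x‖ := by
    refine (sq_le_sq₀ (norm_nonneg _) (norm_nonneg _)).1 ?_
    rw [norm_sq x]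
    nlinarith [sq_nonneg ‖lowPart x‖]
  rw [h3]
  exact h1.trans (h2.trans h4)

/-- Since A commutes with the low projection and with A ^ k Q, the bound in Y applies separately to
the low and to the high part. -/
theorem re_inner_restrict_le {ω : ℝ}
    (hω : ∀ x (h : x ∈ A.op.domain), RCLike.re (inner 𝕜 (A.op ⟨x, h⟩) x) ≤ ω * ‖x‖ ^ 2)
    (x : A.discSpace r) :
    RCLike.re (inner 𝕜 (A.toScale hr k (A.restrict r x)) (A.toScale hr k x))
      ≤ ω * ‖A.toScale hr k x‖ ^ 2 := by
  have e : inner 𝕜 (A.toScale hr k (A.restrict r x)) (A.toScale hr k x)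
      = inner 𝕜 (lowPart (A.toScale hr k (A.restrict r x))) (lowPart (A.toScale hr k x))
        + inner 𝕜 (highPart (A.toScale hr k (A.restrict r x))) (highPart (A.toScale hr k x)) := rfl
  rw [e, norm_sq, map_add, mul_add]
  obtain ⟨h1, h2⟩ := A.op_specProj 1 (A.discSpace_le_domain r x.2)
  refine add_le_add ?_ ?_
  · have h3 : lowPart (A.toScale hr k (A.restrict r x)) = A.op ⟨A.specProj 1 (x : Y), h1⟩ := by
      rw [h2, ← coe_restrict, ← A.val_toScale hr k (A.restrict r x)]
      rfl
    have h4 : lowPart (A.toScale hr k x) = A.specProj 1 (x : Y) :=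
      congrArg (A.specProj 1) (A.val_toScale hr k x)
    rw [h3, h4]
    exact hω _ h1
  · have hz : ∀ n, (x : Y) - A.specProj 1 (x : Y) ∈ (ppow A.op n).domain := fun n =>
      Submodule.sub_mem _ (A.closure_le_domain r n x.2) (A.specProj_mem 1 n _)
    obtain ⟨h5, h6⟩ := ppow_succ_apply' A.op k (hz (k + 1)) (hz k)
    have h3 : highPart (A.toScale hr k x) = ppow A.op k ⟨_, hz k⟩ := by
      rw [highPart_eq]
      exact pmap_congr _ _ _ (by rw [val_toScale])
    have h4 : highPart (A.toScale hr k (A.restrict r x)) = A.op ⟨_, h5⟩ := by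
      rw [highPart_eq, ← h6]
      refine pmap_congr (ppow A.op k) _ (mem_ppow_succ.1 (hz (k + 1))).2 ?_
      rw [val_toScale, coe_restrict, ← h2, ← LinearPMap.map_sub]
      rfl
    rw [h3, h4]
    exact hω _ h5

theorem restrict_toDisc {x : Y} (hx : x ∈ A.op.domain) :
    A.restrict r (A.toDisc r x) = A.toDisc r (A.op ⟨x, hx⟩) := by
  refine Subtype.ext ?_
  obtain ⟨_, h2⟩ := A.op_specProj r hx
  rw [coe_restrict]
  exact h2

end toScale

end NormalOperator

end Galerkin

namespace Galerkin

variable {𝕜 Y : Type*} [RCLike 𝕜] [NormedAddCommGroup Y] [InnerProductSpace 𝕜 Y]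
  {S : ℝ → Y →L[𝕜] Y} {ω : ℝ}

/-! ### Strongly continuous semigroups -/

/-- The absolute value makes the limit two-sided, so that time differences of either sign can be
inserted. -/
theorem IsC0Semigroup.tendsto_abs (hS : IsC0Semigroup S) (x : Y) :
    Tendsto (fun h => S |h| x) (𝓝 0) (𝓝 x) := by
  have h1 : Tendsto (fun t => S t x) (𝓝[≥] 0) (𝓝 x) := by
    rw [← Ioi_insert, nhdsWithin_insert, tendsto_sup]
    refine ⟨?_, hS.continuous x⟩
    have e : S 0 x = x := by rw [hS.zero]; rfl
    have := tendsto_pure_nhds (fun t => S t x) 0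
    rwa [e] at this
  refine h1.comp (tendsto_nhdsWithin_iff.2 ⟨?_, Eventually.of_forall fun h => abs_nonneg h⟩)
  have := (continuous_abs (G := ℝ)).tendsto 0
  rwa [abs_zero] at this

theorem norm_semigroup_le (hω : ∀ t : ℝ, 0 ≤ t → ‖S t‖ ≤ Real.exp (ω * t)) {t b : ℝ}
    (ht : 0 ≤ t) (htb : t ≤ b) : ‖S t‖ ≤ Real.exp (|ω| * b) := by
  refine (hω t ht).trans (Real.exp_le_exp.2 ?_)
  calc ω * t ≤ |ω| * t := by gcongr; exact le_abs_self ω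
    _ ≤ |ω| * b := by gcongr

theorem IsC0Semigroup.norm_sub_le (hS : IsC0Semigroup S)
    (hω : ∀ t : ℝ, 0 ≤ t → ‖S t‖ ≤ Real.exp (ω * t)) {s t b : ℝ} (hs : 0 ≤ s) (hsb : s ≤ b)
    (ht : 0 ≤ t) (htb : t ≤ b) (x : Y) :
    ‖S t x - S s x‖ ≤ Real.exp (|ω| * b) * ‖S |t - s| x - x‖ := by
  wlog hst : s ≤ t generalizing s t
  · rw [norm_sub_rev, abs_sub_comm]
    exact this ht htb hs hsb (le_of_not_ge hst)
  rw [abs_of_nonneg (sub_nonneg.2 hst)]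
  have e : S t x = S s (S (t - s) x) := by
    have := congrArg (fun f : Y →L[𝕜] Y => f x) (hS.add s (t - s) hs (sub_nonneg.2 hst))
    simpa using this
  rw [e, ← map_sub]
  exact (S s).le_of_opNorm_le (norm_semigroup_le hω hs hsb) _

theorem IsC0Semigroup.tendsto_apply (hS : IsC0Semigroup S)
    (hω : ∀ t : ℝ, 0 ≤ t → ‖S t‖ ≤ Real.exp (ω * t)) {ι : Type*} {l : Filter ι} {τ : ι → ℝ}
    {v : ι → Y} {τ₀ : ℝ} {v₀ : Y} (h₀ : 0 ≤ τ₀) (hpos : ∀ᶠ i in l, 0 ≤ τ i)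
    (hτ : Tendsto τ l (𝓝 τ₀)) (hv : Tendsto v l (𝓝 v₀)) :
    Tendsto (fun i => S (τ i) (v i)) l (𝓝 (S τ₀ v₀)) := by
  rw [tendsto_iff_norm_sub_tendsto_zero]
  have h1 : Tendsto (fun i => Real.exp (|ω| * (τ₀ + 1)) * ‖v i - v₀‖
      + Real.exp (|ω| * (τ₀ + 1)) * ‖S |τ i - τ₀| v₀ - v₀‖) l (𝓝 0) := by
    have h2 := (tendsto_iff_norm_sub_tendsto_zero.1 hv).const_mul (Real.exp (|ω| * (τ₀ + 1)))
    have h3 : Tendsto (fun i => τ i - τ₀) l (𝓝 0) := by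
      have := hτ.sub_const τ₀
      rwa [sub_self] at this
    have h4 := (tendsto_iff_norm_sub_tendsto_zero.1 ((hS.tendsto_abs v₀).comp h3)).const_mul
      (Real.exp (|ω| * (τ₀ + 1)))
    have h5 := h2.add h4
    simpa using h5
  refine squeeze_zero' (Eventually.of_forall fun _ => norm_nonneg _) ?_ h1
  filter_upwards [hpos, hτ.eventually (gt_mem_nhds (lt_add_one τ₀))] with i hi hi'
  calc ‖S (τ i) (v i) - S τ₀ v₀‖ = ‖S (τ i) (v i - v₀) + (S (τ i) v₀ - S τ₀ v₀)‖ := by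
        rw [map_sub]; congr 1; abel
    _ ≤ ‖S (τ i) (v i - v₀)‖ + ‖S (τ i) v₀ - S τ₀ v₀‖ := norm_add_le _ _
    _ ≤ _ := add_le_add ((S _).le_of_opNorm_le (norm_semigroup_le hω hi hi'.le) _)
        (hS.norm_sub_le hω h₀ (by linarith) hi hi'.le _)

/-- Cauchy–Schwarz bounds re ⟨S h x - x, x⟩ by (exp (ω h) - 1) ‖x‖ ^ 2; divide by h and let h ↓ 0.
-/
theorem IsGenerator.re_inner_le {A : Y →ₗ.[𝕜] Y} (hA : IsGenerator A S)
    (hω : ∀ t : ℝ, 0 ≤ t → ‖S t‖ ≤ Real.exp (ω * t)) (x : Y) (hx : x ∈ A.domain) :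
    RCLike.re (inner 𝕜 (A ⟨x, hx⟩) x) ≤ ω * ‖x‖ ^ 2 := by
  have h1 := (hA x _).1 (A.mem_graph ⟨x, hx⟩)
  have h2 : Tendsto (fun h : ℝ => RCLike.re (inner 𝕜 (((h⁻¹ : ℝ) : 𝕜) • (S h x - x)) x)) (𝓝[>] 0)
      (𝓝 (RCLike.re (inner 𝕜 (A ⟨x, hx⟩) x))) :=
    (RCLike.continuous_re.tendsto _).comp (h1.inner tendsto_const_nhds)
  have h3 : Tendsto (fun h : ℝ => h⁻¹ * (Real.exp (ω * h) - 1) * ‖x‖ ^ 2) (𝓝[>] 0)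
      (𝓝 (ω * ‖x‖ ^ 2)) := by
    have h4 : HasDerivAt (fun h : ℝ => Real.exp (ω * h)) ω 0 := by
      have := ((hasDerivAt_id (0 : ℝ)).const_mul ω).exp
      simpa using this
    have h5 := hasDerivAt_iff_tendsto_slope.1 h4
    refine Tendsto.mul_const _ ((h5.mono_left (nhdsWithin_mono _ ?_)).congr fun h => ?_)
    · intro h hh; exact ne_of_gt hh
    · simp [slope_def_module]
  refine le_of_tendsto_of_tendsto h2 h3 ?_
  filter_upwards [self_mem_nhdsWithin] with h hh
  have hh : 0 < h := hh
  rw [inner_smul_left, RCLike.conj_ofReal, RCLike.re_ofReal_mul, mul_assoc]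
  refine mul_le_mul_of_nonneg_left ?_ (inv_nonneg.2 hh.le)
  rw [inner_sub_left, map_sub, inner_self_eq_norm_sq]
  have h6 := re_inner_le_norm (𝕜 := 𝕜) (S h x) x
  have h7 := (S h).le_of_opNorm_le (hω h hh.le) x
  nlinarith [norm_nonneg x]

theorem IsC0Semigroup.continuousOn_sub (hS : IsC0Semigroup S)
    (hω : ∀ t : ℝ, 0 ≤ t → ‖S t‖ ≤ Real.exp (ω * t)) {F : ℝ → Y} {a τ : ℝ}
    (hF : ContinuousOn F (Icc a τ)) : ContinuousOn (fun s => S (τ - s) (F s)) (Icc a τ) := by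
  intro s hs
  refine hS.tendsto_apply hω (sub_nonneg.2 hs.2) ?_ ?_ (hF s hs)
  · filter_upwards [self_mem_nhdsWithin] with r hr
    exact sub_nonneg.2 hr.2
  · exact (continuous_const.sub continuous_id).continuousWithinAt

variable [NormedSpace ℝ Y]

theorem real_smul_eq [IsScalarTower ℝ 𝕜 Y] (a : ℝ) (x : Y) : a • x = (a : 𝕜) • x := by
  rw [← smul_one_smul 𝕜 a x, RCLike.real_smul_eq_coe_smul (K := 𝕜)]; simp

theorem IsGenerator.hasDerivWithinAt [IsScalarTower ℝ 𝕜 Y] {A : Y →ₗ.[𝕜] Y} (hA : IsGenerator A S)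
    (hS : IsC0Semigroup S) (t : ℝ) (x : Y) (hx : x ∈ A.domain) :
    HasDerivWithinAt (fun τ => S (τ - t) x) (A ⟨x, hx⟩) (Ici t) t := by
  rw [← hasDerivWithinAt_Ioi_iff_Ici, hasDerivWithinAt_iff_tendsto_slope' self_notMem_Ioi]
  have h1 := (hA x _).1 (A.mem_graph ⟨x, hx⟩)
  have h2 : Tendsto (fun τ => τ - t) (𝓝[>] t) (𝓝[>] 0) := by
    refine tendsto_nhdsWithin_iff.2 ⟨?_, ?_⟩
    · have : Tendsto (fun τ => τ - t) (𝓝 t) (𝓝 (t - t)) := (continuous_sub_right t).tendsto t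
      rw [sub_self] at this
      exact this.mono_left nhdsWithin_le_nhds
    · filter_upwards [self_mem_nhdsWithin] with τ hτ
      exact sub_pos.2 (mem_Ioi.1 hτ)
  refine (h1.comp h2).congr fun τ => ?_
  rw [slope_def_module, sub_self, hS.zero, real_smul_eq (𝕜 := 𝕜)]
  rfl

variable [CompleteSpace Y]

/-- The integrand depends on τ as well, so the fundamental theorem of calculus does not apply
directly. Joint continuity of (σ, s) ↦ S σ (F s) at (0, t) keeps the integrand uniformly close to F
t. -/
theorem IsC0Semigroup.hasDerivWithinAt_integral (hS : IsC0Semigroup S)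
    (hω : ∀ t : ℝ, 0 ≤ t → ‖S t‖ ≤ Real.exp (ω * t)) {F : ℝ → Y} {t T : ℝ} (htT : t < T)
    (hF : ContinuousOn F (Icc t T)) :
    HasDerivWithinAt (fun τ => ∫ s in t..τ, S (τ - s) (F s)) (F t) (Ici t) t := by
  rw [hasDerivWithinAt_iff_isLittleO, Asymptotics.isLittleO_iff]
  intro c hc
  have h0 : S 0 (F t) = F t := by rw [hS.zero]; rfl
  have h1 : Tendsto (fun p : ℝ × ℝ => S p.1 (F p.2)) (𝓝[≥] 0 ×ˢ 𝓝[Icc t T] t) (𝓝 (F t)) := by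
    rw [← h0]
    refine hS.tendsto_apply hω le_rfl ?_ ?_ ?_
    · exact (eventually_mem_nhdsWithin (a := (0 : ℝ)) (s := Ici 0)).prod_inl _
    · exact tendsto_fst.mono_right nhdsWithin_le_nhds
    · exact (hF t ⟨le_rfl, htT.le⟩).tendsto.comp tendsto_snd
  obtain ⟨pa, hpa, pb, hpb, hp⟩ := eventually_prod_iff.1
    (h1.eventually (Metric.closedBall_mem_nhds _ hc))
  obtain ⟨η₁, hη₁, hpa'⟩ := Metric.mem_nhdsWithin_iff.1 hpa
  obtain ⟨η₂, hη₂, hpb'⟩ := Metric.mem_nhdsWithin_iff.1 hpb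
  have hlt : t < min T (t + min η₁ η₂) := by
    have : 0 < min η₁ η₂ := lt_min hη₁ hη₂
    exact lt_min htT (by linarith)
  filter_upwards [Ico_mem_nhdsGE hlt] with τ hτ
  have hτT : τ < T := hτ.2.trans_le (min_le_left _ _)
  have hτη : τ < t + min η₁ η₂ := hτ.2.trans_le (min_le_right _ _)
  have hτ1 : τ - t < η₁ := by have := min_le_left η₁ η₂; linarith
  have hτ2 : τ - t < η₂ := by have := min_le_right η₁ η₂; linarith
  have hint : IntervalIntegrable (fun s => S (τ - s) (F s)) MeasureTheory.volume t τ :=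
    (hS.continuousOn_sub hω (hF.mono (Icc_subset_Icc_right hτT.le))).intervalIntegrable_of_Icc hτ.1
  have e : (∫ s in t..τ, S (τ - s) (F s)) - (∫ s in t..t, S (t - s) (F s)) - (τ - t) • F t
      = ∫ s in t..τ, (S (τ - s) (F s) - F t) := by
    rw [intervalIntegral.integral_same, sub_zero,
      intervalIntegral.integral_sub hint intervalIntegrable_const,
      intervalIntegral.integral_const]
  rw [e, Real.norm_eq_abs]
  refine intervalIntegral.norm_integral_le_of_norm_le_const fun s hs => ?_
  rw [uIoc_of_le hτ.1] at hs
  have h2 : pa (τ - s) := hpa' ⟨by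
    rw [Metric.mem_ball, Real.dist_eq, sub_zero, abs_of_nonneg (sub_nonneg.2 hs.2)]
    linarith [hs.1], sub_nonneg.2 hs.2⟩
  have h3 : pb s := hpb' ⟨by
    rw [Metric.mem_ball, Real.dist_eq, abs_of_nonneg (sub_nonneg.2 hs.1.le)]
    linarith [hs.2], hs.1.le, hs.2.trans hτT.le⟩
  have h4 := hp h2 h3
  rwa [dist_eq_norm] at h4

/-- A mild solution restarted at a later time. -/
theorem IsMildSolution.eq_add_integral {B : Y → Y} {T : ℝ} {U : ℝ → Y}
    (hU : IsMildSolution S B T U) (hS : IsC0Semigroup S)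
    (hω : ∀ t : ℝ, 0 ≤ t → ‖S t‖ ≤ Real.exp (ω * t))
    (hF : ContinuousOn (fun t => B (U t)) (Icc 0 T)) {t τ : ℝ} (ht : 0 ≤ t) (htτ : t ≤ τ)
    (hτ : τ ≤ T) : U τ = S (τ - t) (U t) + ∫ s in t..τ, S (τ - s) (B (U s)) := by
  have hadd : ∀ a b : ℝ, 0 ≤ a → 0 ≤ b → ∀ x, S (a + b) x = S a (S b x) := fun a b ha hb x =>
    congrArg (fun f : Y →L[𝕜] Y => f x) (hS.add a b ha hb)
  have hint : ∀ a b r : ℝ, 0 ≤ a → a ≤ b → b ≤ r → r ≤ T →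
      IntervalIntegrable (fun s => S (r - s) (B (U s))) MeasureTheory.volume a b :=
    fun a b r ha hab hbr hr =>
      ((hS.continuousOn_sub hω (hF.mono (Icc_subset_Icc ha hr))).mono
        (Icc_subset_Icc_right hbr)).intervalIntegrable_of_Icc hab
  have h0τ : 0 ≤ τ - t := sub_nonneg.2 htτ
  rw [hU τ ⟨ht.trans htτ, hτ⟩, hU t ⟨ht, htτ.trans hτ⟩, map_add, ← hadd _ _ h0τ ht,
    sub_add_cancel, add_assoc]
  congr 1
  rw [← intervalIntegral.integral_add_adjacent_intervals (hint 0 t τ le_rfl ht htτ hτ)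
    (hint t τ τ ht htτ le_rfl hτ)]
  congr 1
  rw [← (S (τ - t)).intervalIntegral_comp_comm (hint 0 t t le_rfl ht le_rfl (htτ.trans hτ))]
  refine intervalIntegral.integral_congr fun s hs => ?_
  rw [uIcc_of_le ht] at hs
  show S (τ - s) (B (U s)) = S (τ - t) (S (t - s) (B (U s)))
  rw [← hadd _ _ h0τ (sub_nonneg.2 hs.2), sub_add_sub_cancel]

/-- A mild solution with values in the domain of the generator is differentiable from the right. -/
theorem IsMildSolution.hasDerivWithinAt [IsScalarTower ℝ 𝕜 Y] {A : Y →ₗ.[𝕜] Y} {B : Y → Y}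
    {T : ℝ} {U : ℝ → Y}
    (hU : IsMildSolution S B T U) (hS : IsC0Semigroup S) (hA : IsGenerator A S)
    (hω : ∀ t : ℝ, 0 ≤ t → ‖S t‖ ≤ Real.exp (ω * t))
    (hF : ContinuousOn (fun t => B (U t)) (Icc 0 T)) {t : ℝ} (ht : t ∈ Ico 0 T)
    (hd : U t ∈ A.domain) : HasDerivWithinAt U (A ⟨U t, hd⟩ + B (U t)) (Ici t) t := by
  have h1 := (hA.hasDerivWithinAt hS t (U t) hd).add
    (hS.hasDerivWithinAt_integral hω ht.2 (hF.mono (Icc_subset_Icc_left ht.1)))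
  refine h1.congr_of_eventuallyEq ?_ ?_
  · filter_upwards [Ico_mem_nhdsGE ht.2] with τ hτ
    exact hU.eq_add_integral hS hω hF ht.1 hτ.1 hτ.2.le
  · exact hU.eq_add_integral hS hω hF ht.1 le_rfl ht.2.le

end Galerkin

namespace Galerkin

/-! ### Lipschitz bounds -/

section Lipschitz

variable {E F : Type*} [NormedAddCommGroup E] [NormedSpace ℝ E] [NormedAddCommGroup F]
  [NormedSpace ℝ F]

theorem IsCb.norm_sub_le {n : ℕ} {M : ℕ → ℝ} {f : E → F} {s : Set E} (hf : IsCb n M f s)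
    (hn : 1 ≤ n) (hs : IsOpen s) {c : Set E} (hc : Convex ℝ c) (hcs : c ⊆ s) {x y : E}
    (hx : x ∈ c) (hy : y ∈ c) : ‖f y - f x‖ ≤ M 1 * ‖y - x‖ := by
  refine Convex.norm_image_sub_le_of_norm_fderiv_le (𝕜 := ℝ) (fun z hz => ?_) (fun z hz => ?_)
    hc hx hy
  · exact (hf.contDiffOn.differentiableOn (by exact_mod_cast (by omega : n ≠ 0))).differentiableAt
      (hs.mem_nhds (hcs hz))
  · have h := hf.bound 1 hn z (hcs hz)
    rwa [← zero_add 1, ← norm_iteratedFDerivWithin_fderivWithin hs.uniqueDiffOn (hcs hz),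
      norm_iteratedFDerivWithin_zero, zero_add, fderivWithin_of_isOpen hs (hcs hz)] at h

/-- A ball is connected: it meets s but not the frontier of s, hence cannot leave s. -/
theorem ball_subset_of_lt_infEDist {s : Set E} (hs : IsOpen s) {x : E} (hx : x ∈ s) {δ : ℝ}
    (hδ : 0 < δ) (h : ENNReal.ofReal δ < Metric.infEDist x (frontier s)) :
    Metric.ball x δ ⊆ s := by
  refine (convex_ball x δ).isPreconnected.subset_of_closure_inter_subset hs
    ⟨x, Metric.mem_ball_self hδ, hx⟩ ?_
  rintro y ⟨hy, hyb⟩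
  by_contra hys
  have hf : y ∈ frontier s := ⟨hy, by rwa [hs.interior_eq]⟩
  have h1 := Metric.infEDist_le_edist_of_mem (x := x) hf
  have h2 : edist x y < ENNReal.ofReal δ := by
    rw [edist_dist, ENNReal.ofReal_lt_ofReal_iff hδ, dist_comm]
    exact hyb
  exact absurd (h.trans_le h1) (not_lt.2 h2.le)

end Lipschitz

/-! ### Truncated ordinary differential equations -/

section Truncation

/-- The factor of the radial retraction onto the ball of radius `ρ`. -/
def cutoff (ρ a : ℝ) : ℝ := ρ / max ρ a

variable {ρ : ℝ}

theorem cutoff_nonneg (hρ : 0 < ρ) (a : ℝ) : 0 ≤ cutoff ρ a :=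
  div_nonneg hρ.le (hρ.le.trans (le_max_left _ _))

theorem cutoff_le_one (hρ : 0 < ρ) (a : ℝ) : cutoff ρ a ≤ 1 :=
  (div_le_one (hρ.trans_le (le_max_left _ _))).2 (le_max_left _ _)

theorem cutoff_mul_le (hρ : 0 < ρ) (a : ℝ) : cutoff ρ a * a ≤ ρ := by
  have h : 0 < max ρ a := hρ.trans_le (le_max_left _ _)
  rw [cutoff, div_mul_eq_mul_div, div_le_iff₀ h]
  exact mul_le_mul_of_nonneg_left (le_max_right _ _) hρ.le

theorem cutoff_eq_one (hρ : 0 < ρ) {a : ℝ} (ha : a ≤ ρ) : cutoff ρ a = 1 := by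
  rw [cutoff, max_eq_left ha, div_self hρ.ne']

theorem abs_cutoff_sub_mul_le (hρ : 0 < ρ) (a : ℝ) {b : ℝ} (hb : 0 ≤ b) :
    |cutoff ρ a - cutoff ρ b| * b ≤ |a - b| := by
  have ha' : 0 < max ρ a := hρ.trans_le (le_max_left _ _)
  have hb' : 0 < max ρ b := hρ.trans_le (le_max_left _ _)
  have e : cutoff ρ a - cutoff ρ b = cutoff ρ a * ((max ρ b - max ρ a) / max ρ b) := by
    unfold cutoff
    field_simp
  rw [e, abs_mul, abs_of_nonneg (cutoff_nonneg hρ a), abs_div, abs_of_pos hb']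
  have h1 : |max ρ b - max ρ a| ≤ |a - b| := by
    rw [abs_sub_comm a b]
    refine (abs_max_sub_max_le_max ρ b ρ a).trans_eq ?_
    rw [sub_self, abs_zero, max_eq_right (abs_nonneg _)]
  calc cutoff ρ a * (|max ρ b - max ρ a| / max ρ b) * b
      = cutoff ρ a * |max ρ b - max ρ a| * (b / max ρ b) := by ring
    _ ≤ 1 * |a - b| * 1 := by
      gcongr
      · exact cutoff_le_one hρ a
      · exact (div_le_one hb').2 (le_max_right _ _)
    _ = _ := by ring

variable {E V : Type*} [NormedAddCommGroup E] [NormedSpace ℝ E] [NormedAddCommGroup V]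
  [NormedSpace ℝ V]

/-- One unit of the constant comes from x - y, the other from the variation of the factor. -/
theorem norm_cutoff_smul_sub_le (hρ : 0 < ρ) (x y : V) :
    ‖cutoff ρ ‖x‖ • x - cutoff ρ ‖y‖ • y‖ ≤ 2 * ‖x - y‖ := by
  have e : cutoff ρ ‖x‖ • x - cutoff ρ ‖y‖ • y
      = cutoff ρ ‖x‖ • (x - y) + (cutoff ρ ‖x‖ - cutoff ρ ‖y‖) • y := by
    rw [smul_sub, sub_smul]; abel
  rw [e]
  refine (norm_add_le _ _).trans ?_
  rw [norm_smul, norm_smul, Real.norm_eq_abs, Real.norm_eq_abs,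
    abs_of_nonneg (cutoff_nonneg hρ _)]
  have h1 := abs_cutoff_sub_mul_le hρ ‖x‖ (norm_nonneg y)
  have h2 := abs_norm_sub_norm_le x y
  have h3 := mul_le_mul_of_nonneg_right (cutoff_le_one hρ ‖x‖) (norm_nonneg (x - y))
  linarith

theorem norm_cutoff_smul_le (hρ : 0 < ρ) (x : V) : ‖cutoff ρ ‖x‖ • x‖ ≤ ρ := by
  rw [norm_smul, Real.norm_eq_abs, abs_of_nonneg (cutoff_nonneg hρ _)]
  exact cutoff_mul_le hρ _

/-- An ordinary differential equation whose right-hand side is Lipschitz near a curve `p` has a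
global solution after its argument has been retracted radially to a tube around `p`; the tube is
measured in the norm of a larger space. -/
theorem exists_truncated_solution [CompleteSpace E] (j : E →L[ℝ] V) (hj : ∀ x, ‖x‖ ≤ ‖j x‖)
    {T : ℝ} (hT : 0 ≤ T) {p : ℝ → E} (hp : ContinuousOn p (Icc 0 T)) (hρ : 0 < ρ) {ρ' : ℝ}
    (hρ' : ρ < ρ') {f : E → E} {L : ℝ} (hL : 0 ≤ L)
    (hf : ∀ t ∈ Icc 0 T, ∀ x y, ‖j (x - p t)‖ < ρ' → ‖j (y - p t)‖ < ρ' →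
      ‖f x - f y‖ ≤ L * ‖x - y‖) :
    ∃ u : ℝ → E, u 0 = p 0 ∧ ∀ t ∈ Icc 0 T, HasDerivWithinAt u
      (f (p t + cutoff ρ ‖j (u t - p t)‖ • (u t - p t))) (Icc 0 T) t := by
  have hcut : ∀ w, ‖j (cutoff ρ ‖j w‖ • w)‖ < ρ' := fun w => by
    rw [map_smul]
    exact (norm_cutoff_smul_le hρ _).trans_lt hρ'
  have hfc : ∀ t ∈ Icc 0 T, ∀ x, ‖j (x - p t)‖ < ρ' → ContinuousAt f x := by
    intro t ht x hx
    have hopen : IsOpen {y | ‖j (y - p t)‖ < ρ'} := isOpen_lt (by fun_prop) continuous_const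
    have hlip : LipschitzOnWith ⟨L, hL⟩ f {y | ‖j (y - p t)‖ < ρ'} :=
      LipschitzOnWith.of_dist_le_mul fun y hy z hz => by
        rw [dist_eq_norm, dist_eq_norm]
        exact hf t ht y z hy hz
    exact hlip.continuousOn.continuousAt (hopen.mem_nhds hx)
  set g : ℝ → E → E := fun t x => f (p t + cutoff ρ ‖j (x - p t)‖ • (x - p t)) with hg
  have hgc : ∀ x, ContinuousOn (fun t => g t x) (Icc 0 T) := by
    intro x t ht
    have h1 : ContinuousWithinAt (fun t => p t + cutoff ρ ‖j (x - p t)‖ • (x - p t)) (Icc 0 T) t := by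
      have h2 : ContinuousWithinAt (fun t => x - p t) (Icc 0 T) t := (hp t ht).const_sub x
      have h3 : Continuous fun y : E => cutoff ρ ‖j y‖ • y := by
        unfold cutoff
        refine Continuous.smul (continuous_const.div (by fun_prop) fun y => ?_) continuous_id
        exact (hρ.trans_le (le_max_left _ _)).ne'
      exact (hp t ht).add (h3.continuousAt.comp_continuousWithinAt h2)
    refine (hfc t ht _ ?_).comp_continuousWithinAt h1
    rw [add_sub_cancel_left]
    exact hcut _
  have hglip : ∀ t ∈ Icc 0 T, ∀ x y, ‖g t x - g t y‖ ≤ L * (2 * ‖j‖) * ‖x - y‖ := by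
    intro t ht x y
    have h1 := hf t ht (p t + cutoff ρ ‖j (x - p t)‖ • (x - p t))
      (p t + cutoff ρ ‖j (y - p t)‖ • (y - p t))
      (by rw [add_sub_cancel_left]; exact hcut _) (by rw [add_sub_cancel_left]; exact hcut _)
    refine h1.trans ?_
    rw [mul_assoc]
    refine mul_le_mul_of_nonneg_left ?_ hL
    rw [add_sub_add_left_eq_sub]
    refine (hj _).trans ?_
    rw [map_sub, map_smul, map_smul]
    refine (norm_cutoff_smul_sub_le hρ _ _).trans ?_
    rw [← map_sub, sub_sub_sub_cancel_right, mul_assoc]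
    exact mul_le_mul_of_nonneg_left (j.le_opNorm _) zero_le_two
  have hfp : ContinuousOn (fun t => f (p t)) (Icc 0 T) := fun t ht =>
    (hfc t ht (p t) (by rw [sub_self, map_zero, norm_zero]; exact hρ.trans hρ')
      ).comp_continuousWithinAt (hp t ht)
  obtain ⟨b, hb⟩ := isCompact_Icc.exists_bound_of_continuousOn hfp
  have hb0 : 0 ≤ b := (norm_nonneg _).trans (hb 0 ⟨le_rfl, hT⟩)
  -- The retraction makes this bound independent of x, so the Picard–Lindelöf radius (b + L ρ) T
  -- reaches the whole interval.
  have hgb : ∀ t ∈ Icc 0 T, ∀ x, ‖g t x‖ ≤ b + L * ρ := by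
    intro t ht x
    have h1 := hf t ht (p t + cutoff ρ ‖j (x - p t)‖ • (x - p t)) (p t)
      (by rw [add_sub_cancel_left]; exact hcut _)
      (by rw [sub_self, map_zero, norm_zero]; exact hρ.trans hρ')
    rw [add_sub_cancel_left] at h1
    have h2 : ‖cutoff ρ ‖j (x - p t)‖ • (x - p t)‖ ≤ ρ := by
      refine (hj _).trans ?_
      rw [map_smul]
      exact norm_cutoff_smul_le hρ _
    have h4 := hb t ht
    have h5 := mul_le_mul_of_nonneg_left h2 hL
    have h6 : ‖g t x - f (p t)‖ ≤ L * ‖cutoff ρ ‖j (x - p t)‖ • (x - p t)‖ := h1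
    have h7 := norm_le_norm_add_norm_sub' (g t x) (f (p t))
    linarith
  have hLρ : 0 ≤ b + L * ρ := by positivity
  have hPL : IsPicardLindelof g (tmin := 0) (tmax := T) ⟨0, le_rfl, hT⟩ (p 0)
      ⟨(b + L * ρ) * T, by positivity⟩ 0 ⟨b + L * ρ, hLρ⟩ ⟨L * (2 * ‖j‖), by positivity⟩ :=
    { lipschitzOnWith := fun t ht => LipschitzOnWith.of_dist_le_mul fun x _ y _ => by
        rw [dist_eq_norm, dist_eq_norm]
        exact hglip t ht x y
      continuousOn := fun x _ => hgc x
      norm_le := fun t ht x _ => hgb t ht x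
      mul_max_le := by
        simp only [sub_zero, sub_self, max_eq_left hT, NNReal.coe_zero]
        exact le_rfl }
  obtain ⟨u, hu0, hu⟩ := hPL.exists_eq_forall_mem_Icc_hasDerivWithinAt
    (Metric.mem_closedBall_self le_rfl)
  exact ⟨u, hu0, hu⟩

end Truncation

/-! ### The energy estimate -/

/-- By 2 ε ‖w‖ ≤ ‖w‖ ^ 2 + ε ^ 2, the derivative of ‖w‖ ^ 2 is at most (2 a + 3 L) ‖w‖ ^ 2 + L ε ^
2, and Grönwall's inequality applies to ‖w‖ ^ 2. Right derivatives suffice for it. -/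
theorem norm_le_of_energy {𝕜 V : Type*} [RCLike 𝕜] [NormedAddCommGroup V] [InnerProductSpace 𝕜 V]
    [NormedSpace ℝ V] {w w' : ℝ → V} {T : ℝ} (hw : ContinuousOn w (Icc 0 T)) (h0 : w 0 = 0)
    (hd : ∀ t ∈ Ico 0 T, HasDerivWithinAt w (w' t) (Ici t) t) {a L ε : ℝ} (ha : 0 ≤ a)
    (hL : 0 < L) (hε : 0 ≤ ε)
    (henergy : ∀ t ∈ Ico 0 T, RCLike.re (inner 𝕜 (w' t) (w t))
      ≤ a * ‖w t‖ ^ 2 + L * (‖w t‖ + ε) * ‖w t‖) :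
    ∀ t ∈ Icc 0 T, ‖w t‖ ≤ ε * Real.exp ((2 * a + 3 * L) * T) := by
  set κ := 2 * a + 3 * L with hκ
  have hκ0 : 0 < κ := by positivity
  have key := le_gronwallBound_of_liminf_deriv_right_le (f := fun t => ‖w t‖ ^ 2)
    (f' := fun t => 2 * RCLike.re (inner 𝕜 (w' t) (w t))) (δ := 0) (K := κ) (ε := L * ε ^ 2)
    (a := 0) (b := T) (hw.norm.pow 2) ?_ (by simp [h0]) ?_
  · intro t ht
    have h1 := key t ht
    have hT : 0 ≤ T := ht.1.trans ht.2
    simp only [gronwallBound_of_K_ne_0 hκ0.ne', sub_zero, zero_mul, zero_add] at h1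
    have h2 : L * ε ^ 2 / κ ≤ ε ^ 2 := by
      rw [div_le_iff₀ hκ0, mul_comm]
      refine mul_le_mul_of_nonneg_left ?_ (sq_nonneg ε)
      linarith
    have h3 : Real.exp (κ * t) ≤ Real.exp (κ * T) := Real.exp_le_exp.2 (by gcongr; exact ht.2)
    have h4 : 1 ≤ Real.exp (κ * t) := Real.one_le_exp (mul_nonneg hκ0.le ht.1)
    refine (sq_le_sq₀ (norm_nonneg _) (by positivity)).1 (h1.trans ?_)
    calc L * ε ^ 2 / κ * (Real.exp (κ * t) - 1) ≤ ε ^ 2 * (Real.exp (κ * T) - 0) := by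
          gcongr
          · linarith
      -- The exponential is squared, at the price of a factor two in the exponent, to avoid a square
      -- root.
      _ ≤ ε ^ 2 * (Real.exp (κ * T) * Real.exp (κ * T)) := by
          gcongr
          have h5 : 1 ≤ Real.exp (κ * T) := h4.trans h3
          nlinarith
      _ = _ := by ring
  · intro t ht r hr
    have h1 : HasDerivWithinAt (fun t => ‖w t‖ ^ 2) (2 * RCLike.re (inner 𝕜 (w' t) (w t)))
        (Ici t) t := by
      have h2 := (RCLike.reCLM (K := 𝕜)).hasFDerivAt.comp_hasDerivWithinAt t
        ((hd t ht).inner 𝕜 (hd t ht))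
      have e : RCLike.reCLM (K := 𝕜) (inner 𝕜 (w t) (w' t) + inner 𝕜 (w' t) (w t))
          = 2 * RCLike.re (inner 𝕜 (w' t) (w t)) := by
        rw [RCLike.reCLM_apply, map_add, inner_re_symm (w t)]
        ring
      rw [e] at h2
      refine h2.congr_of_eventuallyEq (Eventually.of_forall fun s => ?_) ?_
      · simp
      · simp
    have h2 := h1.liminf_right_slope_le hr
    simpa [slope_def_field, div_eq_inv_mul] using h2
  · intro t ht
    have h1 := henergy t ht
    have h2 : 0 ≤ L * (‖w t‖ - ε) ^ 2 := by positivity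
    rw [hκ]
    nlinarith

end Galerkin

namespace Galerkin

/-! ### The projected system -/

section Projected

open NormalOperator NormalOperator.Scale

variable {𝕜 Y : Type*} [RCLike 𝕜] [NormedAddCommGroup Y] [InnerProductSpace 𝕜 Y] [CompleteSpace Y]
  {A : NormalOperator 𝕜 Y} {B : Y → Y} {D : (k : ℕ) → Set (A.Scale k)} {K N : ℕ}
  {M : ℕ → ℕ → ℝ}

namespace NonlinearityCondition

theorem val_onScale (hB : NonlinearityCondition A B D K N M) {k : ℕ} (hk : k ≤ K) {x : A.Scale k}
    (hx : x ∈ D k) : val (onScale A B k x) = B (val x) := by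
  rw [onScale, dif_pos (hB.mapsTo k hk x hx)]
  rfl

theorem incl_mem (hB : NonlinearityCondition A B D K N M) {x : A.Scale K} (hx : x ∈ D K) {k : ℕ}
    (hk : k ≤ K) : incl hk x ∈ D k := by
  induction hk using Nat.decreasingInduction with
  | self => exact hx
  | of_succ k hk ih => exact hB.nested k hk _ ih

theorem continuousOn (hB : NonlinearityCondition A B D K N M) {k : ℕ} (hk : k ≤ K) :
    ContinuousOn (onScale A B k) (D k) := (hB.cb k hk).contDiffOn.continuousOn

theorem norm_toScale_sub_le (hB : NonlinearityCondition A B D K N M) (hKN : K < N) {k : ℕ}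
    (hk : k ≤ K) {r : ℝ} (hr : 1 ≤ r) {c : Set (A.Scale k)} (hc : Convex ℝ c) (hcD : c ⊆ D k)
    {x y : A.Scale k} (hx : x ∈ c) (hy : y ∈ c) :
    ‖A.toScale hr k (A.toDisc r (B (val y) - B (val x)))‖ ≤ M k 1 * ‖y - x‖ := by
  rw [← hB.val_onScale hk (hcD hx), ← hB.val_onScale hk (hcD hy), ← map_sub]
  exact (A.norm_toScale_toDisc_le hr k _).trans
    ((hB.cb k hk).norm_sub_le (by omega) (hB.isOpen k hk) hc hcD hx hy)

variable [NormedSpace ℝ Y] [IsScalarTower ℝ 𝕜 Y]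

/-- This is the energy inequality for w' = c A w + P (B(p + c w) - B(x)), with c the retraction
factor. Since c ω may exceed ω when ω < 0, the bound has |ω|. The Lipschitz bound acts on c w + (p -
x), of norm at most ‖w‖ + ε. -/
theorem re_inner_le (hB : NonlinearityCondition A B D K N M) (hKN : K < N) {ω : ℝ}
    (hω : ∀ x (h : x ∈ A.op.domain), RCLike.re (inner 𝕜 (A.op ⟨x, h⟩) x) ≤ ω * ‖x‖ ^ 2) {k : ℕ}
    (hk : k ≤ K) {r : ℝ} (hr : 1 ≤ r) {x : A.Scale k} {δ : ℝ} (hδ : 0 < δ)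
    (hx : Metric.ball x δ ⊆ D k) {L : ℝ} (hL : 0 ≤ L) (hML : M k 1 ≤ L) {p w : A.discSpace r}
    {c ε : ℝ} (hc0 : 0 ≤ c) (hc1 : c ≤ 1) (hp : ‖A.toScale hr k p - x‖ ≤ ε)
    (hpw : ‖A.toScale hr k (p + c • w) - x‖ < δ) :
    RCLike.re (inner 𝕜 (A.toScale hr k
      ((A.restrict r (p + c • w) + A.toDisc r (B (p + c • w : A.discSpace r)))
        - (A.restrict r p + A.toDisc r (B (val x))))) (A.toScale hr k w))
      ≤ |ω| * ‖A.toScale hr k w‖ ^ 2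
        + L * (‖A.toScale hr k w‖ + ε) * ‖A.toScale hr k w‖ := by
  have e : (A.restrict r (p + c • w) + A.toDisc r (B (p + c • w : A.discSpace r)))
        - (A.restrict r p + A.toDisc r (B (val x)))
      = (c : 𝕜) • A.restrict r w
        + A.toDisc r (B (val (A.toScale hr k (p + c • w))) - B (val x)) := by
    rw [val_toScale, map_sub, map_add, real_smul_eq (𝕜 := 𝕜), map_smul]
    abel
  rw [e, map_add, map_smul, inner_add_left, inner_smul_left, RCLike.conj_ofReal, map_add,
    RCLike.re_ofReal_mul]
  refine add_le_add ?_ ?_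
  · calc c * _ ≤ c * (ω * ‖A.toScale hr k w‖ ^ 2) :=
          mul_le_mul_of_nonneg_left (A.re_inner_restrict_le hr k hω w) hc0
      _ ≤ 1 * (|ω| * ‖A.toScale hr k w‖ ^ 2) := by
          have h1 : ω * ‖A.toScale hr k w‖ ^ 2 ≤ |ω| * ‖A.toScale hr k w‖ ^ 2 :=
            mul_le_mul_of_nonneg_right (le_abs_self ω) (sq_nonneg _)
          exact (mul_le_mul_of_nonneg_left h1 hc0).trans
            (mul_le_mul_of_nonneg_right hc1 (by positivity))
      _ = _ := one_mul _
  · refine (re_inner_le_norm _ _).trans (mul_le_mul_of_nonneg_right ?_ (norm_nonneg _))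
    have h1 := hB.norm_toScale_sub_le hKN hk hr (convex_ball x δ) hx (Metric.mem_ball_self hδ)
      (y := A.toScale hr k (p + c • w)) (by rwa [Metric.mem_ball, dist_eq_norm])
    refine h1.trans (mul_le_mul hML ?_ (norm_nonneg _) hL)
    have e2 : A.toScale hr k (p + c • w) - x
        = c • A.toScale hr k w + (A.toScale hr k p - x) := by
      rw [map_add, real_smul_eq (𝕜 := 𝕜) c w, map_smul, ← real_smul_eq (𝕜 := 𝕜) c]
      abel
    rw [e2]
    refine (norm_add_le _ _).trans (add_le_add ?_ hp)
    rw [norm_smul, Real.norm_eq_abs, abs_of_nonneg hc0]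
    exact mul_le_of_le_one_left (norm_nonneg _) hc1

end NonlinearityCondition

variable [NormedSpace ℝ Y] [IsScalarTower ℝ 𝕜 Y]

/-- Existence and error bound for the projected system, with explicit constants. -/
theorem exists_projected_solution (hB : NonlinearityCondition A B D K N M) (hKN : K < N)
    {S : ℝ → Y →L[𝕜] Y} (hS : IsC0Semigroup S) (hA : IsGenerator A.op S) {ω : ℝ}
    (hω : ∀ t : ℝ, 0 ≤ t → ‖S t‖ ≤ Real.exp (ω * t))
    (hDs : ∀ x ∈ D (K + 1), x.incl K.le_succ ∈ D K) {R : ℝ} (hR0 : 0 ≤ R)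
    (hDR : ∀ x ∈ D (K + 1), ‖x‖ ≤ R) {δ T : ℝ} (hδ : 0 < δ) (hT : 0 ≤ T)
    {LK L0 : ℝ} (hLK : 0 < LK) (hMK : M K 1 ≤ LK) (hL0 : 0 < L0) (hM0 : M 0 1 ≤ L0)
    {m : ℕ} (hm : 0 < m)
    (hmδ : R / m * Real.exp ((2 * |ω| + 3 * LK) * T) < δ / 4)
    {U : ℝ → A.Scale (K + 1)} (hUc : ContinuousOn U (Icc 0 T))
    (hUD : ∀ t ∈ Icc 0 T, U t ∈ shrink D δ (K + 1))
    (hU : IsMildSolution S B T (fun t => (U t).val)) :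
    ∃ u : ℝ → A.Scale (K + 1),
      ContinuousOn u (Icc 0 T) ∧
      (∀ t ∈ Icc 0 T, (u t).incl K.le_succ ∈ D K) ∧
      IsProjectedSolution A B m T (U 0).val (fun t => (u t).val) ∧
      ∀ t ∈ Icc 0 T, ‖(U t).val - (u t).val‖
        ≤ R * (1 + Real.exp ((2 * |ω| + 3 * L0) * T)) / (m : ℝ) ^ (K + 1) := by
  have hr : (1 : ℝ) ≤ m := by exact_mod_cast hm
  have hm0 : (0 : ℝ) < m := by linarith
  have hdiss := hA.re_inner_le hω
  set p : ℝ → A.discSpace m := fun t => A.toDisc m (U t).val with hpdef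
  -- the tube around the solution
  have hUk : ∀ t ∈ Icc 0 T, ∀ k (hk : k ≤ K), incl (hk.trans K.le_succ) (U t) ∈ D k :=
    fun t ht k hk => hB.incl_mem (hDs _ (hUD t ht).1) hk
  have hball : ∀ t ∈ Icc 0 T, ∀ k (hk : k ≤ K),
      Metric.ball (incl (hk.trans K.le_succ) (U t)) δ ⊆ D k := fun t ht k hk =>
    ball_subset_of_lt_infEDist (hB.isOpen k hk) (hUk t ht k hk) hδ ((hUD t ht).2 k _)
  have htail : ∀ t ∈ Icc 0 T, ∀ k (hk : k ≤ K),
      ‖A.toScale hr k (p t) - incl (hk.trans K.le_succ) (U t)‖ ≤ R / (m : ℝ) ^ (K + 1 - k) := by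
    intro t ht k hk
    obtain ⟨d, hd⟩ := Nat.exists_eq_add_of_le (hk.trans K.le_succ)
    have h1 : ∀ (l : ℕ) (hl : k ≤ l) (_ : l = k + d) (x : A.Scale l),
        (m : ℝ) ^ d * ‖incl hl x - A.toScale hr k (A.toDisc m (val x))‖ ≤ ‖x‖ := by
      rintro l hl rfl x
      exact A.pow_mul_norm_incl_sub_toScale_le hr k d x
    have h2 := (h1 _ (hk.trans K.le_succ) hd (U t)).trans (hDR _ (hUD t ht).1)
    have h3 : K + 1 - k = d := by omega
    rw [norm_sub_rev, le_div_iff₀ (by positivity), mul_comm, h3]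
    exact h2
  have hexp : 1 ≤ Real.exp ((2 * |ω| + 3 * LK) * T) := Real.one_le_exp (by positivity)
  have hRm : R / m < δ / 4 := by
    have h1 : 0 ≤ R / m := by positivity
    nlinarith
  have htailK : ∀ t ∈ Icc 0 T, ‖A.toScale hr K (p t) - incl K.le_succ (U t)‖ ≤ R / m := by
    intro t ht
    have h1 := htail t ht K le_rfl
    rwa [Nat.add_sub_cancel_left, pow_one] at h1
  -- the truncated system
  let f : A.discSpace m → A.discSpace m := fun v => A.restrict m v + A.toDisc m (B v)
  let j : A.discSpace m →L[ℝ] A.Scale K := (A.toScale hr K).restrictScalars ℝ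
  have hval : Continuous fun x : A.Scale (K + 1) => val x := (valL A (K + 1)).continuous
  have hp : ContinuousOn p (Icc 0 T) := (A.toDisc m).continuous.comp_continuousOn
    (hval.comp_continuousOn hUc)
  have hnear : ∀ t ∈ Icc 0 T, ∀ x : A.discSpace m, ‖A.toScale hr K (x - p t)‖ < δ / 2 →
      ‖A.toScale hr K x - incl K.le_succ (U t)‖ < δ := by
    intro t ht x hx
    have e : A.toScale hr K x - incl K.le_succ (U t)
        = A.toScale hr K (x - p t) + (A.toScale hr K (p t) - incl K.le_succ (U t)) := by
      rw [map_sub]; abel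
    rw [e]
    refine (norm_add_le _ _).trans_lt ?_
    linarith [htailK t ht]
  -- This constant depends on m and A; it serves existence only and does not enter the error bound.
  have hlip : ∀ t ∈ Icc 0 T, ∀ x y, ‖j (x - p t)‖ < δ / 2 → ‖j (y - p t)‖ < δ / 2 →
      ‖f x - f y‖ ≤ (‖A.restrict m‖ + LK * ‖A.toScale hr K‖) * ‖x - y‖ := by
    intro t ht x y hx hy
    have e : f x - f y = A.restrict m (x - y)
        + A.toDisc m (B (val (A.toScale hr K x)) - B (val (A.toScale hr K y))) := by
      show A.restrict m x + A.toDisc m (B x) - (A.restrict m y + A.toDisc m (B y)) = _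
      rw [val_toScale, val_toScale, map_sub, map_sub]
      abel
    have h1 := hB.norm_toScale_sub_le hKN le_rfl hr (convex_ball _ δ) (hball t ht K le_rfl)
      (x := A.toScale hr K y) (y := A.toScale hr K x)
      (by rw [Metric.mem_ball, dist_eq_norm]; exact hnear t ht y hy)
      (by rw [Metric.mem_ball, dist_eq_norm]; exact hnear t ht x hx)
    rw [e, add_mul]
    refine (norm_add_le _ _).trans (add_le_add ((A.restrict m).le_opNorm _) ?_)
    refine (A.norm_le_norm_toScale hr K _).trans (h1.trans ?_)
    rw [mul_assoc, ← map_sub]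
    exact mul_le_mul hMK ((A.toScale hr K).le_opNorm _) (norm_nonneg _) hLK.le
  have hρ : 0 < δ / 4 := by positivity
  obtain ⟨u, hu0, hu⟩ := exists_truncated_solution j (A.norm_le_norm_toScale hr K) hT hp hρ
    (show δ / 4 < δ / 2 by linarith) (by positivity) hlip
  -- the error
  set w : ℝ → A.discSpace m := fun t => u t - p t with hwdef
  set c : ℝ → ℝ := fun t => cutoff (δ / 4) ‖j (w t)‖ with hcdef
  have huc : ContinuousOn u (Icc 0 T) := fun t ht => (hu t ht).continuousWithinAt
  have hw0 : w 0 = 0 := sub_eq_zero.2 hu0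
  have hwc : ContinuousOn w (Icc 0 T) := huc.sub hp
  have hFc : ContinuousOn (fun t => B (U t).val) (Icc 0 T) := by
    have h1 : ContinuousOn (fun t => incl (Nat.zero_le (K + 1)) (U t)) (Icc 0 T) :=
      (inclL A (Nat.zero_le (K + 1))).continuous.comp_continuousOn hUc
    have h2 := (valL A 0).continuous.comp_continuousOn
      ((hB.continuousOn (Nat.zero_le K)).comp h1 fun t ht => hUk t ht 0 (Nat.zero_le K))
    refine h2.congr fun t ht => ?_
    exact (hB.val_onScale (Nat.zero_le K) (hUk t ht 0 (Nat.zero_le K))).symm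
  have hUd : ∀ t, val (U t) ∈ A.op.domain := fun t => (mem_ppow_succ.1 (val_mem (U t))).1
  have hwd : ∀ t ∈ Ico 0 T, HasDerivWithinAt w
      (f (p t + c t • w t) - (A.restrict m (p t) + A.toDisc m (B (U t).val))) (Ici t) t := by
    intro t ht
    have h1 := (hu t ⟨ht.1, ht.2.le⟩).mono_of_mem_nhdsWithin (Icc_mem_nhdsGE_of_mem ht)
    have h2 := hU.hasDerivWithinAt hS hA hω hFc ht (hUd t)
    have h3 := ((A.toDisc m).restrictScalars ℝ).hasFDerivAt.comp_hasDerivWithinAt t h2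
    have e : (A.toDisc m).restrictScalars ℝ (A.op ⟨val (U t), hUd t⟩ + B (val (U t)))
        = A.restrict m (p t) + A.toDisc m (B (U t).val) := by
      rw [hpdef, A.restrict_toDisc (hUd t), ← map_add]
      rfl
    rw [e] at h3
    exact h1.sub h3
  have htube : ∀ t ∈ Icc 0 T,
      ‖A.toScale hr K (p t + c t • w t) - incl K.le_succ (U t)‖ < δ := by
    intro t ht
    refine hnear t ht _ ?_
    rw [add_sub_cancel_left]
    have h1 := norm_cutoff_smul_le hρ (j (w t))
    rw [← map_smul] at h1
    exact h1.trans_lt (by linarith)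
  -- The tube is measured in the norm of the K-th space, which dominates the k-th norm; so one
  -- truncated solution serves all k.
  have hest : ∀ k (hk : k ≤ K) (L : ℝ), 0 < L → M k 1 ≤ L → ∀ t ∈ Icc 0 T,
      ‖A.toScale hr k (w t)‖
        ≤ R / (m : ℝ) ^ (K + 1 - k) * Real.exp ((2 * |ω| + 3 * L) * T) := by
    intro k hk L hL hML
    refine norm_le_of_energy (𝕜 := 𝕜) (w := fun t => A.toScale hr k (w t))
      ((A.toScale hr k).continuous.comp_continuousOn hwc) (by rw [hw0, map_zero])
      (fun t ht => ((A.toScale hr k).restrictScalars ℝ).hasFDerivAt.comp_hasDerivWithinAt t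
        (hwd t ht)) (abs_nonneg ω) hL (by positivity) fun t ht => ?_
    have ht' : t ∈ Icc 0 T := ⟨ht.1, ht.2.le⟩
    refine hB.re_inner_le hKN hdiss hk hr hδ (hball t ht' k hk) hL.le hML
      (cutoff_nonneg hρ _) (cutoff_le_one hρ _) (htail t ht' k hk) ?_
    have h1 := norm_incl_le hk (A.toScale hr K (p t + c t • w t) - incl K.le_succ (U t))
    rw [map_sub, incl_toScale] at h1
    exact h1.trans_lt (htube t ht')
  -- The case k = K: w stays within the retraction radius, so the factor is 1 and u solves the
  -- projected system itself.
  have hsmall : ∀ t ∈ Icc 0 T, ‖j (w t)‖ ≤ δ / 4 := by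
    intro t ht
    have h1 := hest K le_rfl LK hLK hMK t ht
    rw [Nat.add_sub_cancel_left, pow_one] at h1
    exact h1.trans hmδ.le
  have hpu : ∀ t ∈ Icc 0 T, p t + c t • w t = u t := by
    intro t ht
    have h1 : c t = 1 := cutoff_eq_one hρ (hsmall t ht)
    rw [h1, one_smul, hwdef, add_sub_cancel]
  refine ⟨fun t => A.toScale hr (K + 1) (u t),
    (A.toScale hr (K + 1)).continuous.comp_continuousOn huc, fun t ht => ?_, ?_, fun t ht => ?_⟩
  · rw [incl_toScale]
    refine hball t ht K le_rfl ?_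
    rw [Metric.mem_ball, dist_eq_norm, ← hpu t ht]
    exact htube t ht
  · simp only [val_toScale]
    refine ⟨?_, fun t _ => A.specProj_eq_self (u t).2, fun t ht => ?_⟩
    · rw [hu0]; rfl
    · refine ⟨A.discSpace_le_domain m (u t).2, ?_⟩
      have h1 := hu t ht
      rw [hpu t ht] at h1
      have h2 := ((A.discSpace m).subtypeL.restrictScalars ℝ).hasFDerivAt.comp_hasDerivWithinAt t h1
      rw [← A.coe_restrict]
      exact h2
  · rw [val_toScale]
    have h1 := htail t ht 0 (Nat.zero_le K)
    have h2 := hest 0 (Nat.zero_le K) L0 hL0 hM0 t ht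
    rw [norm_eq_norm_val, map_sub, val_toScale, Nat.sub_zero] at h1
    rw [norm_toScale_zero, Nat.sub_zero] at h2
    have e : (U t).val - (u t : Y) = -((p t : Y) - (U t).val) - (w t : Y) := by
      rw [hwdef, Submodule.coe_sub]; abel
    rw [e]
    refine (norm_sub_le _ _).trans ?_
    rw [norm_neg]
    calc _ ≤ R / (m : ℝ) ^ (K + 1)
          + R / (m : ℝ) ^ (K + 1) * Real.exp ((2 * |ω| + 3 * L0) * T) := add_le_add h1 h2
      _ = _ := by ring

end Projected

end Galerkin

end

/-! ### Choice of the uniform constants -/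

theorem mainTheorem8 (K N : ℕ) (hKN : K < N) (M : ℕ → ℕ → ℝ) (ω R δ T : ℝ) (hδ : 0 < δ)
    (hT : 0 ≤ T) :
    ∃ (mstar : ℕ) (C : ℝ), 0 < mstar ∧
      ∀ (𝕜 Y : Type*) [RCLike 𝕜] [NormedAddCommGroup Y] [InnerProductSpace 𝕜 Y] [CompleteSpace Y]
        [NormedSpace ℝ Y] [IsScalarTower ℝ 𝕜 Y]
        (A : NormalOperator 𝕜 Y) (S : ℝ → Y →L[𝕜] Y)
        (_hS : IsC0Semigroup S) (_hA : IsGenerator A.op S)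
        (_hω : ∀ t : ℝ, 0 ≤ t → ‖S t‖ ≤ Real.exp (ω * t))
        (B : Y → Y) (D : (k : ℕ) → Set (A.Scale k))
        (_hB : NonlinearityCondition A B D K N M)
        (_hDo : IsOpen (D (K + 1)))
        (_hDs : ∀ x ∈ D (K + 1), x.incl K.le_succ ∈ D K)
        (_hDR : ∀ x ∈ D (K + 1), ‖x‖ ≤ R)
        (_hne : (shrink D δ (K + 1)).Nonempty)
        (m : ℕ) (_hm : mstar ≤ m)
        (U : ℝ → A.Scale (K + 1))
        (_hUc : ContinuousOn U (Set.Icc 0 T))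
        (_hUD : ∀ t ∈ Set.Icc 0 T, U t ∈ shrink D δ (K + 1))
        (_hU : IsMildSolution S B T (fun t => (U t).val)),
        ∃ u : ℝ → A.Scale (K + 1),
          ContinuousOn u (Set.Icc 0 T) ∧
          (∀ t ∈ Set.Icc 0 T, (u t).incl K.le_succ ∈ D K) ∧
          IsProjectedSolution A B m T (U 0).val (fun t => (u t).val) ∧
          ∀ t ∈ Set.Icc 0 T, ‖(U t).val - (u t).val‖ ≤ C / (m : ℝ) ^ (K + 1) := by
  -- The maximum with 1 secures the positive Lipschitz constant that the energy estimate requires.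
  set LK := max (M K 1) 1 with hLK
  set L0 := max (M 0 1) 1 with hL0
  set G := Real.exp ((2 * |ω| + 3 * LK) * T)
  -- This makes |R| G / m < δ / 4 for m ≥ n, the smallness that disables the retraction; taking n +
  -- 1 also ensures m > 0.
  obtain ⟨n, hn⟩ := exists_nat_gt (4 * (|R| * G) / δ)
  refine ⟨n + 1, |R| * (1 + Real.exp ((2 * |ω| + 3 * L0) * T)), n.succ_pos, ?_⟩
  intro 𝕜 Y _ _ _ _ _ _ A S hS hA hω B D hB _ hDs hDR _ m hm U hUc hUD hU
  have hm0 : 0 < m := n.succ_pos.trans_le hm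
  have hm1 : (0 : ℝ) < m := by exact_mod_cast hm0
  have hnm : (n : ℝ) ≤ m := by exact_mod_cast (n.le_succ.trans hm)
  refine exists_projected_solution hB hKN hS hA hω hDs (abs_nonneg R)
    (fun x hx => (hDR x hx).trans (le_abs_self R)) hδ hT
    (zero_lt_one.trans_le (le_max_right _ _)) (le_max_left _ _)
    (zero_lt_one.trans_le (le_max_right _ _)) (le_max_left _ _) hm0 ?_ hUc hUD hU
  have h1 := hn.trans_le hnm
  rw [div_lt_iff₀ hδ] at h1
  rw [div_mul_eq_mul_div, div_lt_iff₀ hm1]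
  linarith
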